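/- **Conventions.** Languages are many-sorted; structures may have empty sorts; multivariables $x,y,z,\dots$ are finite tuples of sorted variables, and $M_x$ is the set of tuples from $M$ of the sorts of $x$. A *monster model* of a complete theory $T'$ in a language $\mathcal L'$ is a model $\mathbb M$ for which there is a cardinal $\kappa>|\mathcal L'|$ such that $\mathbb M$ is $\kappa$-saturated and every reduct of $\mathbb M$ is strongly $\kappa$-homogeneous. A complete theory $T'$ is *distal* if in a monster model $\mathbb M$ of $T'$ the following holds: for every $A\subseteq\mathbb M$, every multivariable $x$, every linear order $I=I_1+(c)+I_2$ with $I_1,I_2$ infinite, and every ($\emptyset$-)indiscernible sequence $(a_i)_{i\in I}$ from $\mathbb M_x$, if $(a_i)_{i\in I_1+I_2}$ is $A$-indiscernible, then $(a_i)_{i\in I}$ is $A$-indiscernible. The order $I=I_1+(c)+I_2$ is *in distal configuration at $c$* if $I_1,I_2$ are infinite, $I_1$ has no greatest element and $I_2$ has no least element. **Setting.** Let $\mathcal L$ be a language and $T$ a complete $\mathcal L$-theory. Let $\mathcal L(\mathfrak F)=\mathcal L\cup\mathfrak F$, where $\mathfrak F$ is a set of new unary function symbols between sorts of $\mathcal L$,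 let $T(\mathfrak F)$ be a complete $\mathcal L(\mathfrak F)$-theory extending $T$, and let $\mathbb M$ be a monster model of $T(\mathfrak F)$. For a subset $X$ of a structure, $\langle X\rangle$ denotes the $\mathcal L$-substructure generated by $X$, and $M\langle c\rangle:=\langle M\cup c\rangle$. **Theorem (Distal Criterion).** Suppose that $T$ is distal and that the following conditions hold: 1. $T(\mathfrak F)$ has quantifier elimination. 2. For every $\mathfrak f\in\mathfrak F$, every model $(N,\mathfrak F)\models T(\mathfrak F)$, every nonempty $\mathcal L$-substructure $M\subseteq N$ (some sorts of $M$ may be empty) with $\mathfrak g(M)\subseteq M$ for all $\mathfrak g\in\mathfrak F$, every multivariable $x$ and every $c\in N_x$, there are a multivariable $y$ and a tuple $d\in\mathfrak f(M\langle c\rangle)_y$ such that $$\mathfrak f(M\langle c\rangle)\subseteq\langle \mathfrak f(M),d\rangle .$$ 3. For every $\mathfrak f\in\mathfrak F$ the following holds. Let $x'$ be an initial segment of $x$, let $g$ and $h$ be $\mathcal L$-terms in the variables $xy$ and $x'z$ respectively, with the value of $g$ in the source sort and that of $h$ in the target sort of $\mathfrak f$, let $b_1\in\mathbb M_y$ and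 $b_2\in\mathfrak f(\mathbb M)_z$, and let $(a_i)_{i\in I}$ be an $\mathcal L(\mathfrak F)$-indiscernible sequence from $\mathfrak f(\mathbb M)_{x'}\times\mathbb M_{x\setminus x'}$ such that (a) $I=I_1+(c)+I_2$ is in distal configuration at $c$ and $(a_i)_{i\in I_1+I_2}$ is $b_1b_2$-indiscernible (in $\mathcal L(\mathfrak F)$), and (b) $\mathfrak f(g(a_i,b_1))=h(a_i,b_2)$ for every $i\in I_1+I_2$ (here $h(a_i,b_2)$ uses only the $x'$-part of $a_i$). Then $\mathfrak f(g(a_c,b_1))=h(a_c,b_2)$. Then $T(\mathfrak F)$ is distal. -/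

import Mathlib

universe u v w

/-! Many-sorted first-order logic, up to monster models, indiscernible sequences and distality. -/

namespace ManySorted

/-- A many-sorted first-order language. A function symbol in `Func n σ s` takes `n` arguments of
sorts `σ 0, …, σ (n-1)` and has values of sort `s`. -/
structure Language where
  Sorts : Type u
  Func : (n : ℕ) → (Fin n → Sorts) → Sorts → Type u
  Rel : (n : ℕ) → (Fin n → Sorts) → Type u

/-- The cardinality `|L|` of a language: the maximum of `ℵ₀` and the number of sorts and symbols. -/
noncomputable def Language.card (L : Language.{u}) : Cardinal.{u} :=
  max Cardinal.aleph0
    (Cardinal.mk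
      (L.Sorts ⊕ (Σ (n : ℕ) (σ : Fin n → L.Sorts) (s : L.Sorts), L.Func n σ s)
        ⊕ (Σ (n : ℕ) (σ : Fin n → L.Sorts), L.Rel n σ)))

/-- An `L`-structure. Empty sorts are allowed. -/
structure Str (L : Language.{u}) where
  carrier : L.Sorts → Type u
  fn : ∀ {n : ℕ} {σ : Fin n → L.Sorts} {s : L.Sorts},
    L.Func n σ s → (∀ i, carrier (σ i)) → carrier s
  rel : ∀ {n : ℕ} {σ : Fin n → L.Sorts}, L.Rel n σ → (∀ i, carrier (σ i)) → Prop

instance (L : Language.{u}) : CoeFun (Str L) (fun _ => L.Sorts → Type u) := ⟨Str.carrier⟩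

/-- A multivariable is a family of sorts `x : X → L.Sorts` (finite when `X` is);
`Tuple M x` is the set `M_x` of tuples of the corresponding sorts. -/
abbrev Tuple {L : Language.{u}} (M : Str L) {X : Type v} (x : X → L.Sorts) : Type (max u v) :=
  ∀ i, M (x i)

/-- Concatenation of tuples; the concatenation `xy` of multivariables is `Sum.elim x y`. -/
def Tuple.join {L : Language.{u}} {M : Str L} {X : Type v} {Y : Type w}
    {x : X → L.Sorts} {y : Y → L.Sorts} (a : Tuple M x) (b : Tuple M y) :
    Tuple M (Sum.elim x y)
  | Sum.inl i => a i
  | Sum.inr j => b j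

/-- The tuple `(m, a)`. -/
def Tuple.cons {L : Language.{u}} {M : Str L} {n : ℕ} {s : L.Sorts} {σ : Fin n → L.Sorts}
    (m : M s) (a : Tuple M σ) : Tuple M (Fin.cons s σ : Fin (n + 1) → L.Sorts) :=
  Fin.cases (motive := fun i => M ((Fin.cons s σ : Fin (n + 1) → L.Sorts) i)) m a

/-- The empty tuple. -/
def Tuple.nil {L : Language.{u}} {M : Str L} {x : Empty → L.Sorts} : Tuple M x :=
  fun i => i.elim

/-- `L`-terms in the variables `x`, indexed by their sort. -/
inductive Term (L : Language.{u}) {X : Type v} (x : X → L.Sorts) : L.Sorts → Type (max u v)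
  | var (i : X) : Term L x (x i)
  | app {n : ℕ} {σ : Fin n → L.Sorts} {s : L.Sorts} (f : L.Func n σ s)
      (ts : ∀ i, Term L x (σ i)) : Term L x s

def Term.eval {L : Language.{u}} (M : Str L) {X : Type v} {x : X → L.Sorts} (a : Tuple M x) :
    ∀ {s : L.Sorts}, Term L x s → M s
  | _, .var i => a i
  | _, .app f ts => M.fn f (fun i => (ts i).eval M a)

/-- `L`-formulas with free variables among `x` and among finitely many further variables of sorts
`σ`, which serve for quantification; `all s φ` binds the new variable number `0`, of sort `s`. -/
inductive BFormula (L : Language.{u}) {X : Type v} (x : X → L.Sorts) :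
    (n : ℕ) → (Fin n → L.Sorts) → Type (max u v)
  | falsum {n : ℕ} {σ : Fin n → L.Sorts} : BFormula L x n σ
  | equal {n : ℕ} {σ : Fin n → L.Sorts} {s : L.Sorts} (t₁ t₂ : Term L (Sum.elim x σ) s) :
      BFormula L x n σ
  | rel {n : ℕ} {σ : Fin n → L.Sorts} {m : ℕ} {ρ : Fin m → L.Sorts} (R : L.Rel m ρ)
      (ts : ∀ i, Term L (Sum.elim x σ) (ρ i)) : BFormula L x n σ
  | imp {n : ℕ} {σ : Fin n → L.Sorts} (φ ψ : BFormula L x n σ) : BFormula L x n σ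
  | all {n : ℕ} {σ : Fin n → L.Sorts} (s : L.Sorts)
      (φ : BFormula L x (n + 1) (Fin.cons s σ)) : BFormula L x n σ

/-- Satisfaction of formulas; the other connectives are the usual abbreviations. -/
def BFormula.Realize {L : Language.{u}} (M : Str L) {X : Type v} {x : X → L.Sorts}
    (a : Tuple M x) : ∀ {n : ℕ} {σ : Fin n → L.Sorts}, BFormula L x n σ → Tuple M σ → Prop
  | _, _, .falsum, _ => False
  | _, _, .equal t₁ t₂, b => t₁.eval M (a.join b) = t₂.eval M (a.join b)
  | _, _, .rel R ts, b => M.rel R (fun i => (ts i).eval M (a.join b))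
  | _, _, .imp φ ψ, b => φ.Realize M a b → ψ.Realize M a b
  | _, _, .all s φ, b => ∀ m : M s, φ.Realize M a (Tuple.cons m b)

/-- No quantifier occurs in the formula. -/
def BFormula.IsQF {L : Language.{u}} {X : Type v} {x : X → L.Sorts} :
    ∀ {n : ℕ} {σ : Fin n → L.Sorts}, BFormula L x n σ → Prop
  | _, _, .falsum => True
  | _, _, .equal _ _ => True
  | _, _, .rel _ _ => True
  | _, _, .imp φ ψ => φ.IsQF ∧ ψ.IsQF
  | _, _, .all _ _ => False

/-- `L`-formulas `φ(x)`. -/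
abbrev Formula (L : Language.{u}) {X : Type v} (x : X → L.Sorts) : Type (max u v) :=
  BFormula L x 0 Fin.elim0

/-- `M ⊨ φ(a)`. -/
def Formula.Holds {L : Language.{u}} (M : Str L) {X : Type v} {x : X → L.Sorts}
    (φ : Formula L x) (a : Tuple M x) : Prop :=
  BFormula.Realize M a φ (fun i => i.elim0)

abbrev Sentence (L : Language.{u}) : Type u :=
  Formula L (Empty.elim : Empty → L.Sorts)

abbrev Theory (L : Language.{u}) : Type u := Set (Sentence L)

/-- `M ⊨ T`. -/
def Str.Models {L : Language.{u}} (M : Str L) (T : Theory L) : Prop :=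
  ∀ φ ∈ T, Formula.Holds M φ Tuple.nil

/-- `T` has a model, and every sentence is true in all models of `T` or false in all of them. -/
def Theory.IsComplete {L : Language.{u}} (T : Theory L) : Prop :=
  (∃ M : Str L, M.Models T) ∧
    ∀ φ : Sentence L,
      (∀ M : Str L, M.Models T → Formula.Holds M φ Tuple.nil) ∨
      (∀ M : Str L, M.Models T → ¬ Formula.Holds M φ Tuple.nil)

/-- Quantifier elimination. -/
def Theory.HasQE {L : Language.{u}} (T : Theory L) : Prop :=
  ∀ (X : Type) [Finite X] (x : X → L.Sorts) (φ : Formula L x),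
    ∃ ψ : Formula L x, BFormula.IsQF ψ ∧
      ∀ M : Str L, M.Models T → ∀ a : Tuple M x,
        (Formula.Holds M φ a ↔ Formula.Holds M ψ a)

/-! ### Sorted subsets and substructures -/

/-- Subsets of a many-sorted structure: a subset of each sort. -/
abbrev SSet {L : Language.{u}} (M : Str L) : Type u := ∀ s, Set (M s)

/-- The set of coordinates of a tuple. -/
inductive InCoords {L : Language.{u}} {M : Str L} {X : Type v} {x : X → L.Sorts}
    (a : Tuple M x) : ∀ s, M s → Prop
  | coord (i : X) : InCoords a (x i) (a i)

def Tuple.coords {L : Language.{u}} {M : Str L} {X : Type v} {x : X → L.Sorts}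
    (a : Tuple M x) : SSet M := fun s => {m | InCoords a s m}

/-- `A` is the underlying set of a substructure of `M`. -/
def IsSubstructure {L : Language.{u}} {M : Str L} (A : SSet M) : Prop :=
  ∀ {n : ℕ} {σ : Fin n → L.Sorts} {s : L.Sorts} (f : L.Func n σ s) (a : ∀ i, M (σ i)),
    (∀ i, a i ∈ A (σ i)) → M.fn f a ∈ A s

inductive InSpan {L : Language.{u}} {M : Str L} (A : SSet M) : ∀ s, M s → Prop
  | base {s : L.Sorts} {m : M s} : m ∈ A s → InSpan A s m
  | app {n : ℕ} {σ : Fin n → L.Sorts} {s : L.Sorts} (f : L.Func n σ s) (a : ∀ i, M (σ i)) :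
      (∀ i, InSpan A (σ i) (a i)) → InSpan A s (M.fn f a)

/-- `⟨A⟩`, the substructure of `M` generated by `A`. -/
def span {L : Language.{u}} (M : Str L) (A : SSet M) : SSet M := fun s => {m | InSpan A s m}

/-! ### Reducts, saturation, monster models -/

/-- An inclusion of languages: it exhibits `L'` as a sublanguage of `L`. -/
structure Inclusion (L' L : Language.{u}) where
  srt : L'.Sorts → L.Sorts
  func : ∀ {n : ℕ} {σ : Fin n → L'.Sorts} {s : L'.Sorts},
    L'.Func n σ s → L.Func n (fun i => srt (σ i)) (srt s)
  rel : ∀ {n : ℕ} {σ : Fin n → L'.Sorts}, L'.Rel n σ → L.Rel n (fun i => srt (σ i))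
  srt_injective : Function.Injective srt
  func_injective : ∀ {n : ℕ} {σ : Fin n → L'.Sorts} {s : L'.Sorts},
    Function.Injective (func (n := n) (σ := σ) (s := s))
  rel_injective : ∀ {n : ℕ} {σ : Fin n → L'.Sorts},
    Function.Injective (rel (n := n) (σ := σ))

/-- The reduct of an `L`-structure to a sublanguage. -/
def Str.reduct {L' L : Language.{u}} (M : Str L) (ι : Inclusion L' L) : Str L' where
  carrier s := M (ι.srt s)
  fn f a := M.fn (ι.func f) a
  rel R a := M.rel (ι.rel R) a

/-- Automorphisms of a structure. -/
structure Aut {L : Language.{u}} (M : Str L) where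
  equiv : ∀ s, M s ≃ M s
  map_fn : ∀ {n : ℕ} {σ : Fin n → L.Sorts} {s : L.Sorts} (f : L.Func n σ s) (a : ∀ i, M (σ i)),
    equiv s (M.fn f a) = M.fn f (fun i => equiv (σ i) (a i))
  map_rel : ∀ {n : ℕ} {σ : Fin n → L.Sorts} (R : L.Rel n σ) (a : ∀ i, M (σ i)),
    M.rel R (fun i => equiv (σ i) (a i)) ↔ M.rel R a

/-- The elements of `A`, as the family of all parameters from `A`. -/
abbrev SSet.Elems {L : Language.{u}} {M : Str L} (A : SSet M) : Type u := Σ s, A s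

abbrev SSet.elemSort {L : Language.{u}} {M : Str L} (A : SSet M) : A.Elems → L.Sorts :=
  fun p => p.1

abbrev SSet.elemVal {L : Language.{u}} {M : Str L} (A : SSet M) : Tuple M A.elemSort :=
  fun p => p.2.1

/-- `κ`-saturation: each set of formulas over fewer than `κ` parameters, in a finite multivariable,
is realized as soon as it is finitely satisfiable. -/
def Str.IsSaturated {L : Language.{u}} (M : Str L) (κ : Cardinal.{u}) : Prop :=
  ∀ A : SSet M, Cardinal.mk A.Elems < κ →
    ∀ (X : Type) [Finite X] (x : X → L.Sorts) (Φ : Set (Formula L (Sum.elim x A.elemSort))),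
      (∀ Φ₀ : Set (Formula L (Sum.elim x A.elemSort)), Φ₀ ⊆ Φ → Φ₀.Finite →
        ∃ a : Tuple M x, ∀ φ ∈ Φ₀, Formula.Holds M φ (a.join A.elemVal)) →
      ∃ a : Tuple M x, ∀ φ ∈ Φ, Formula.Holds M φ (a.join A.elemVal)

/-- Strong `κ`-homogeneity: each elementary map from a subset of size less than `κ` into `M`
extends to an automorphism of `M`. -/
def Str.IsStronglyHomogeneous {L : Language.{u}} (M : Str L) (κ : Cardinal.{u}) : Prop :=
  ∀ A : SSet M, Cardinal.mk A.Elems < κ →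
    ∀ h : Tuple M A.elemSort,
      (∀ φ : Formula L A.elemSort, Formula.Holds M φ A.elemVal ↔ Formula.Holds M φ h) →
      ∃ g : Aut M, ∀ p : A.Elems, g.equiv p.1 p.2.1 = h p

/-- `M` is a monster model of `T`: for some `κ > |L|` it is `κ`-saturated, and all its reducts are
strongly `κ`-homogeneous. -/
def Str.IsMonster {L : Language.{u}} (M : Str L) (T : Theory L) : Prop :=
  M.Models T ∧ ∃ κ : Cardinal.{u}, L.card < κ ∧ M.IsSaturated κ ∧
    ∀ (L' : Language.{u}) (ι : Inclusion L' L), (M.reduct ι).IsStronglyHomogeneous κ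

/-! ### Indiscernible sequences and distality -/

/-- The subsequence `(a_i)_{i ∈ J}` is indiscernible over the family of parameters `e`. -/
def IndiscernibleOver {L : Language.{u}} {M : Str L} {X : Type} {x : X → L.Sorts}
    {I : Type u} [LinearOrder I] (a : I → Tuple M x) (J : Set I)
    {P : Type v} {p : P → L.Sorts} (e : Tuple M p) : Prop :=
  ∀ (n : ℕ) (φ : Formula L (Sum.elim (fun k : Fin n × X => x k.2) p)) (i j : Fin n → I),
    StrictMono i → StrictMono j → (∀ k, i k ∈ J) → (∀ k, j k ∈ J) →
    (Formula.Holds M φ (Tuple.join (fun k => a (i k.1) k.2) e) ↔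
      Formula.Holds M φ (Tuple.join (fun k => a (j k.1) k.2) e))

/-- The whole sequence `(a_i)_{i ∈ I}` is indiscernible (over `∅`). -/
def Indiscernible {L : Language.{u}} {M : Str L} {X : Type} {x : X → L.Sorts}
    {I : Type u} [LinearOrder I] (a : I → Tuple M x) : Prop :=
  IndiscernibleOver a Set.univ (Tuple.nil (M := M) (x := (Empty.elim : Empty → L.Sorts)))

/-- `T` is distal: in a monster model, if `I = I₁ + (c) + I₂` with `I₁`, `I₂` infinite,
`(a_i)_{i ∈ I}` is indiscernible and `(a_i)_{i ∈ I₁ + I₂}` is `A`-indiscernible, then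
`(a_i)_{i ∈ I}` is `A`-indiscernible. Here `I₁` and `I₂` are the parts of `I` below and above `c`. -/
def Theory.IsDistal {L : Language.{u}} (T : Theory L) : Prop :=
  ∀ M : Str L, M.IsMonster T →
    ∀ (A : SSet M) (X : Type) [Finite X] (x : X → L.Sorts)
      (I : Type u) [LinearOrder I] (c : I), (Set.Iio c).Infinite → (Set.Ioi c).Infinite →
      ∀ a : I → Tuple M x, Indiscernible a →
        IndiscernibleOver a {i | i ≠ c} A.elemVal →
        IndiscernibleOver a Set.univ A.elemVal

/-- `I = I₁ + (c) + I₂` is in distal configuration at `c`: both parts are infinite, `I₁` has no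
greatest and `I₂` no least element. -/
def DistalConfiguration {I : Type u} [LinearOrder I] (c : I) : Prop :=
  (Set.Iio c).Infinite ∧ (Set.Ioi c).Infinite ∧
    (¬ ∃ i, IsGreatest (Set.Iio c) i) ∧ (¬ ∃ i, IsLeast (Set.Ioi c) i)

/-! ### Expansions by unary functions -/

/-- The function symbols of `L(F)`: those of `L`, and each `f : F s t` as a new unary function
symbol from sort `s` to sort `t`. -/
inductive ExpFunc (L : Language.{u}) (F : L.Sorts → L.Sorts → Type u) :
    (n : ℕ) → (Fin n → L.Sorts) → L.Sorts → Type u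
  | old {n : ℕ} {σ : Fin n → L.Sorts} {s : L.Sorts} (f : L.Func n σ s) : ExpFunc L F n σ s
  | new {s t : L.Sorts} (f : F s t) : ExpFunc L F 1 (fun _ => s) t

/-- The language `L(F)`. -/
def Language.expand (L : Language.{u}) (F : L.Sorts → L.Sorts → Type u) : Language.{u} where
  Sorts := L.Sorts
  Func := ExpFunc L F
  Rel := L.Rel

variable {L : Language.{u}} {F : L.Sorts → L.Sorts → Type u}

/-- The reduct of an `L(F)`-structure to `L`. -/
def Str.base (N : Str (L.expand F)) : Str L where
  carrier := N.carrier
  fn f a := N.fn (ExpFunc.old f) a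
  rel R a := N.rel (L := L.expand F) R a

/-- The interpretation in `N` of the symbol `f : F s t`. -/
def Str.unary (N : Str (L.expand F)) {s t : L.Sorts} (f : F s t) (a : N.base s) : N.base t :=
  N.fn (σ := fun _ => s) (s := t) (ExpFunc.new f) (fun _ => a)

inductive InImage (N : Str (L.expand F)) {s t : L.Sorts} (f : F s t) (A : SSet N.base) :
    ∀ r, N.base r → Prop
  | mk (a : N.base s) : a ∈ A s → InImage N f A t (N.unary f a)

/-- `f(A)`, as a sorted set: it lives in the target sort of `f` and is empty in all others. -/
def image (N : Str (L.expand F)) {s t : L.Sorts} (f : F s t) (A : SSet N.base) : SSet N.base :=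
  fun r => {b | InImage N f A r b}

end ManySorted

open ManySorted

/-! By quantifier elimination, only quantifier-free formulas `φ(a_i, e)` with a finite parameter
tuple `e` have to be considered. Such a formula differs from an `L`-formula only through the values
`f(t(a_i, e))` of new functions. Suppose each of these values is an `L`-term in an enlarged sequence
with enlarged parameters, still indiscernible, and off `c` still indiscernible over the parameters.
Then `φ` is an `L`-formula along the sequence, and distality of `T` settles it. `Config` records
such a sequence, `Config.Refinement` such an enlargement, and `Config.formDefRefined_realize`
removes the new symbols by induction.

The heart is a single application of `f`, in `Config.exists_refinement_unary`. Let `M` be the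
`L(F)`-substructure generated by the `a_i` with `i < c`. Condition 2 gives a finite tuple `d` from
`f(M⟨e⟩)` with `f(M⟨e⟩) ⊆ ⟨f(M), d⟩`. Only finitely many `a_i` enter into `d`; choose `i₀ < c`
beyond them. Then `f(t(a_{i₀}, e)) = h(w, d)` for an `L`-term `h` and a finite tuple `w` from
`f(M)`. Keep the indices below `i₀` that occur, move those above `i₀` past `c`, and let `i₀` vary.
Indiscernibility over `e` off `c` yields `f(t(a_i, e)) = h(w_i, d)` for all `i ≠ c` close to `c`,
with the same `d`. Condition 3 extends the equation to `i = c`. Adding `w_i` to the sequence and `d`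
to the parameters turns the value into a term.

Condition 3 concerns one monster model and sequences in distal configuration, whereas distality
concerns all monster models and arbitrary infinite sides. `exists_stretched_sequence` bridges this
gap: by compactness, a counterexample anywhere yields one in the given monster model, indexed by the
rationals, where a formula separates single members. -/

namespace ManySorted

/-! ### Substitution -/

section Substitution

variable {L : Language.{u}}

def Term.subst {X : Type v} {Y : Type w} {x : X → L.Sorts} {y : Y → L.Sorts}
    (τ : ∀ i, Term L y (x i)) : ∀ {s : L.Sorts}, Term L x s → Term L y s
  | _, .var i => τ i
  | _, .app f ts => .app f (fun i => (ts i).subst τ)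

theorem Term.eval_subst (M : Str L) {X : Type v} {Y : Type w} {x : X → L.Sorts} {y : Y → L.Sorts}
    (τ : ∀ i, Term L y (x i)) (a : Tuple M y) {s : L.Sorts} (t : Term L x s) :
    (t.subst τ).eval M a = t.eval M (fun i => (τ i).eval M a) := by
  induction t with
  | var i => rfl
  | app f ts ih => simp only [Term.subst, Term.eval, ih]

/-- The weakening of a term along a new bound variable. -/
def Term.shift {X : Type v} {x : X → L.Sorts} {n : ℕ} {σ : Fin n → L.Sorts} (r : L.Sorts)
    {s : L.Sorts} (t : Term L (Sum.elim x σ) s) :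
    Term L (Sum.elim x (Fin.cons r σ : Fin (n + 1) → L.Sorts)) s :=
  t.subst (fun
    | Sum.inl i => (Term.var (Sum.inl i) :
        Term L (Sum.elim x (Fin.cons r σ : Fin (n + 1) → L.Sorts)) (x i))
    | Sum.inr k => (Term.var (Sum.inr k.succ) :
        Term L (Sum.elim x (Fin.cons r σ : Fin (n + 1) → L.Sorts)) (σ k)))

theorem Term.eval_shift (M : Str L) {X : Type v} {x : X → L.Sorts} {n : ℕ} {σ : Fin n → L.Sorts}
    {r s : L.Sorts} (t : Term L (Sum.elim x σ) s) (a : Tuple M x) (b : Tuple M σ) (m : M r) :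
    (t.shift r).eval M (a.join (Tuple.cons m b)) = t.eval M (a.join b) := by
  rw [Term.shift, Term.eval_subst]
  congr 1
  funext k
  cases k <;> rfl

/-- The extension of a substitution under a quantifier. -/
def liftSubst {X : Type v} {Y : Type w} {x : X → L.Sorts} {y : Y → L.Sorts}
    {n m : ℕ} {σ : Fin n → L.Sorts} {ρ : Fin m → L.Sorts} (r : L.Sorts)
    (τ : ∀ i, Term L (Sum.elim y ρ) (Sum.elim x σ i)) :
    ∀ i, Term L (Sum.elim y (Fin.cons r ρ : Fin (m + 1) → L.Sorts))
      (Sum.elim x (Fin.cons r σ : Fin (n + 1) → L.Sorts) i)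
  | Sum.inl i => (τ (Sum.inl i)).shift r
  | Sum.inr k => Fin.cases
      (motive := fun k => Term L (Sum.elim y (Fin.cons r ρ : Fin (m + 1) → L.Sorts))
        ((Fin.cons r σ : Fin (n + 1) → L.Sorts) k))
      (Term.var (Sum.inr 0) : Term L (Sum.elim y (Fin.cons r ρ : Fin (m + 1) → L.Sorts)) r)
      (fun k => (τ (Sum.inr k)).shift r) k

def BFormula.subst {X : Type v} {Y : Type w} {x : X → L.Sorts} {y : Y → L.Sorts} :
    ∀ {n m : ℕ} {σ : Fin n → L.Sorts} {ρ : Fin m → L.Sorts},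
      (∀ i, Term L (Sum.elim y ρ) (Sum.elim x σ i)) → BFormula L x n σ → BFormula L y m ρ
  | _, _, _, _, _, .falsum => .falsum
  | _, _, _, _, τ, .equal t₁ t₂ => .equal (t₁.subst τ) (t₂.subst τ)
  | _, _, _, _, τ, .rel R ts => .rel R (fun i => (ts i).subst τ)
  | _, _, _, _, τ, .imp φ ψ => .imp (φ.subst τ) (ψ.subst τ)
  | _, _, _, _, τ, .all s φ => .all s (φ.subst (liftSubst s τ))

/-- The hypothesis compares values rather than terms. It therefore survives `liftSubst` under a
quantifier, both sides receiving the same new value. -/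
theorem BFormula.realize_subst (M : Str L) {X : Type v} {Y : Type w} {x : X → L.Sorts}
    {y : Y → L.Sorts} {n : ℕ} {σ : Fin n → L.Sorts} (φ : BFormula L x n σ)
    (a : Tuple M y) (a' : Tuple M x) :
    ∀ {m : ℕ} {ρ : Fin m → L.Sorts} (τ : ∀ i, Term L (Sum.elim y ρ) (Sum.elim x σ i))
      (b : Tuple M ρ) (b' : Tuple M σ),
      (∀ i, (τ i).eval M (a.join b) = (a'.join b') i) →
      ((φ.subst τ).Realize M a b ↔ φ.Realize M a' b') := by
  induction φ with
  | falsum => intros; rfl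
  | equal t₁ t₂ =>
    intro m ρ τ b b' h
    simp only [BFormula.subst, BFormula.Realize, Term.eval_subst]
    rw [funext h]
  | rel R ts =>
    intro m ρ τ b b' h
    simp only [BFormula.subst, BFormula.Realize, Term.eval_subst]
    rw [funext h]
  | imp φ ψ ih₁ ih₂ =>
    intro m ρ τ b b' h
    simp only [BFormula.subst, BFormula.Realize, ih₁ τ b b' h, ih₂ τ b b' h]
  | all s φ ih =>
    intro m ρ τ b b' h
    simp only [BFormula.subst, BFormula.Realize]
    refine forall_congr' fun c => ih _ _ _ ?_
    rintro (i | k)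
    · exact (Term.eval_shift M _ _ _ _).trans (h (Sum.inl i))
    · refine Fin.cases ?_ (fun k => ?_) k
      · rfl
      · exact (Term.eval_shift M _ _ _ _).trans (h (Sum.inr k))

def Formula.subst {X : Type v} {Y : Type w} {x : X → L.Sorts} {y : Y → L.Sorts}
    (τ : ∀ i, Term L y (x i)) (φ : Formula L x) : Formula L y :=
  BFormula.subst (ρ := Fin.elim0)
    (fun
      | Sum.inl i => (τ i).subst (fun j =>
          (Term.var (Sum.inl j) : Term L (Sum.elim y (Fin.elim0 : Fin 0 → L.Sorts)) (y j)))
      | Sum.inr k => k.elim0) φ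

theorem Formula.holds_subst (M : Str L) {X : Type v} {Y : Type w} {x : X → L.Sorts}
    {y : Y → L.Sorts} (τ : ∀ i, Term L y (x i)) (φ : Formula L x) (a : Tuple M y) :
    (φ.subst τ).Holds M a ↔ φ.Holds M (fun i => (τ i).eval M a) := by
  refine BFormula.realize_subst M φ _ _ _ _ _ ?_
  rintro (i | k)
  · exact Term.eval_subst M _ _ _
  · exact k.elim0

/-! ### Connectives and quantifiers -/

theorem Formula.exists_true {X : Type v} (x : X → L.Sorts) :
    ∃ χ : Formula L x, ∀ (M : Str L) (a : Tuple M x), χ.Holds M a :=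
  ⟨.imp .falsum .falsum, fun _ _ h => h⟩

theorem Formula.exists_not {X : Type v} {x : X → L.Sorts} (φ : Formula L x) :
    ∃ χ : Formula L x, ∀ (M : Str L) (a : Tuple M x), χ.Holds M a ↔ ¬ φ.Holds M a :=
  ⟨.imp φ .falsum, fun _ _ => Iff.rfl⟩

theorem Formula.exists_and {X : Type v} {x : X → L.Sorts} (φ ψ : Formula L x) :
    ∃ χ : Formula L x, ∀ (M : Str L) (a : Tuple M x),
      χ.Holds M a ↔ (φ.Holds M a ∧ ψ.Holds M a) := by
  refine ⟨.imp (.imp φ (.imp ψ .falsum)) .falsum, fun M a => ?_⟩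
  simp only [Formula.Holds, BFormula.Realize]
  tauto

theorem Formula.exists_iff {X : Type v} {x : X → L.Sorts} (φ ψ : Formula L x) :
    ∃ χ : Formula L x, ∀ (M : Str L) (a : Tuple M x),
      χ.Holds M a ↔ (φ.Holds M a ↔ ψ.Holds M a) := by
  obtain ⟨χ, hχ⟩ := Formula.exists_and (.imp φ ψ : Formula L x) (.imp ψ φ)
  refine ⟨χ, fun M a => (hχ M a).trans ?_⟩
  simp only [Formula.Holds, BFormula.Realize]
  tauto

theorem Formula.exists_conj {X : Type v} {x : X → L.Sorts} {Φ : Set (Formula L x)}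
    (hΦ : Φ.Finite) :
    ∃ χ : Formula L x, ∀ (M : Str L) (a : Tuple M x),
      χ.Holds M a ↔ ∀ φ ∈ Φ, φ.Holds M a := by
  induction Φ, hΦ using Set.Finite.induction_on with
  | empty =>
    obtain ⟨χ, hχ⟩ := Formula.exists_true x
    exact ⟨χ, fun M a => by simp [hχ M a]⟩
  | insert _ _ ih =>
    rename_i φ Φ _ _
    obtain ⟨χ, hχ⟩ := ih
    obtain ⟨ξ, hξ⟩ := Formula.exists_and φ χ
    exact ⟨ξ, fun M a => by simp [hξ M a, hχ M a]⟩

theorem Formula.exists_exists_single {X : Type v} {x : X → L.Sorts} {s : L.Sorts}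
    (φ : Formula L (Sum.elim x (fun _ : Unit => s))) :
    ∃ χ : Formula L x, ∀ (M : Str L) (a : Tuple M x),
      χ.Holds M a ↔ ∃ m : M s, φ.Holds M (a.join (fun _ => m)) := by
  let τ : ∀ i, Term L (Sum.elim x (Fin.cons s Fin.elim0 : Fin 1 → L.Sorts))
      (Sum.elim (Sum.elim x (fun _ : Unit => s)) (Fin.elim0 : Fin 0 → L.Sorts) i) := fun
    | Sum.inl (Sum.inl i) =>
        (Term.var (Sum.inl i) : Term L (Sum.elim x (Fin.cons s Fin.elim0 : Fin 1 → L.Sorts)) (x i))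
    | Sum.inl (Sum.inr _) =>
        (Term.var (Sum.inr 0) : Term L (Sum.elim x (Fin.cons s Fin.elim0 : Fin 1 → L.Sorts)) s)
    | Sum.inr k => k.elim0
  refine ⟨.imp (.all s (.imp (BFormula.subst τ φ) .falsum)) .falsum, fun M a => ?_⟩
  simp only [Formula.Holds, BFormula.Realize]
  rw [← not_forall_not, not_iff_not]
  refine forall_congr' fun m => not_congr ?_
  refine BFormula.realize_subst M φ _ _ _ _ _ ?_
  rintro ((i | i) | k)
  · rfl
  · rfl
  · exact k.elim0

/-- Variable `0` is split off as a `Unit`-indexed variable and quantified; the recursion takes care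
of the others. -/
theorem Formula.exists_exists_fin {X : Type v} {x : X → L.Sorts} : ∀ {n : ℕ}
    {σ : Fin n → L.Sorts} (φ : Formula L (Sum.elim x σ)),
    ∃ χ : Formula L x, ∀ (M : Str L) (a : Tuple M x),
      χ.Holds M a ↔ ∃ b : Tuple M σ, φ.Holds M (a.join b)
  | 0, σ, φ => by
    refine ⟨φ.subst (fun
      | Sum.inl i => (Term.var i : Term L x (x i))
      | Sum.inr k => k.elim0), fun M a => ?_⟩
    rw [Formula.holds_subst]
    constructor
    · intro h
      refine ⟨fun k => k.elim0, ?_⟩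
      convert h using 1
      funext k
      rcases k with i | k
      · rfl
      · exact k.elim0
    · rintro ⟨b, h⟩
      convert h using 1
      funext k
      rcases k with i | k
      · rfl
      · exact k.elim0
  | n + 1, σ, φ => by
    let y : X ⊕ Fin n → L.Sorts := Sum.elim x (fun k => σ k.succ)
    let φ' : Formula L (Sum.elim y (fun _ : Unit => σ 0)) := φ.subst (fun
      | Sum.inl i => (Term.var (Sum.inl (Sum.inl i)) : Term L (Sum.elim y (fun _ : Unit => σ 0)) (x i))
      | Sum.inr k => Fin.cases (motive := fun k => Term L (Sum.elim y (fun _ : Unit => σ 0)) (σ k))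
          (Term.var (Sum.inr ()) : Term L (Sum.elim y (fun _ : Unit => σ 0)) (σ 0))
          (fun k => (Term.var (Sum.inl (Sum.inr k)) :
            Term L (Sum.elim y (fun _ : Unit => σ 0)) (σ k.succ))) k)
    have hφ' : ∀ (M : Str L) (a : Tuple M x) (b : Tuple M σ),
        φ'.Holds M (Tuple.join (M := M) (x := y) (a.join (fun k => b (Fin.succ k)))
          (fun _ => b 0)) ↔ φ.Holds M (a.join b) := by
      intro M a b
      refine (Formula.holds_subst M _ φ _).trans ?_
      have : ∀ c c' : Tuple M (Sum.elim x σ), c = c' → (φ.Holds M c ↔ φ.Holds M c') := by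
        rintro c _ rfl; rfl
      apply this
      funext k
      rcases k with i | k
      · rfl
      · refine Fin.cases ?_ (fun k => ?_) k <;> rfl
    obtain ⟨χ, hχ⟩ := Formula.exists_exists_single φ'
    obtain ⟨ξ, hξ⟩ := Formula.exists_exists_fin χ
    refine ⟨ξ, fun M a => (hξ M a).trans ?_⟩
    constructor
    · rintro ⟨b, h⟩
      obtain ⟨m, h⟩ := (hχ M _).1 h
      refine ⟨Fin.cases (motive := fun k => M (σ k)) m b, ?_⟩
      rw [← hφ']
      exact h
    · rintro ⟨b, h⟩
      refine ⟨fun k => b k.succ, (hχ M _).2 ⟨b 0, ?_⟩⟩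
      exact (hφ' M a b).2 h

theorem Formula.exists_exists {X : Type v} {x : X → L.Sorts} {W : Type w} [Finite W]
    {y : W → L.Sorts} (φ : Formula L (Sum.elim x y)) :
    ∃ χ : Formula L x, ∀ (M : Str L) (a : Tuple M x),
      χ.Holds M a ↔ ∃ b : Tuple M y, φ.Holds M (a.join b) := by
  obtain ⟨n, ⟨e⟩⟩ := Finite.exists_equiv_fin W
  let z : X ⊕ Fin n → L.Sorts := Sum.elim x (fun k => y (e.symm k))
  obtain ⟨τ, hτ⟩ : ∃ τ : ∀ i, Term L z (Sum.elim x y i), ∀ (M : Str L) (a : Tuple M x)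
      (b : Tuple M y) i, (τ i).eval M
        (Tuple.join (x := x) (y := fun k => y (e.symm k)) a (fun k => b (e.symm k))) =
        (a.join b) i := by
    have : ∀ i, ∃ t : Term L z (Sum.elim x y i), ∀ (M : Str L) (a : Tuple M x)
      (b : Tuple M y), t.eval M
        (Tuple.join (x := x) (y := fun k => y (e.symm k)) a (fun k => b (e.symm k))) =
        (a.join b) i := by
      rintro (i | k)
      · exact ⟨(Term.var (Sum.inl i) : Term L z (x i)), fun _ _ _ => rfl⟩
      · obtain ⟨k, rfl⟩ := e.symm.surjective k
        exact ⟨(Term.var (Sum.inr k) : Term L z (y (e.symm k))), fun _ _ _ => rfl⟩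
    choose τ hτ using this
    exact ⟨τ, fun M a b i => hτ i M a b⟩
  obtain ⟨χ, hχ⟩ := Formula.exists_exists_fin (x := x) (σ := fun k => y (e.symm k)) (φ.subst τ)
  refine ⟨χ, fun M a => (hχ M a).trans ?_⟩
  have hφ : ∀ b : Tuple M y, (φ.subst τ).Holds M
      (Tuple.join (x := x) (y := fun k => y (e.symm k)) a (fun k => b (e.symm k))) ↔
      φ.Holds M (a.join b) := fun b => by
    rw [Formula.holds_subst]
    rw [show (fun i => (τ i).eval M (Tuple.join (x := x) (y := fun k => y (e.symm k)) a
      (fun k => b (e.symm k)))) = a.join b from funext (hτ M a b)]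
  constructor
  · rintro ⟨b, h⟩
    obtain ⟨b, rfl⟩ : ∃ b' : Tuple M y, (fun k => b' (e.symm k)) = b := by
      -- The sort at `k` agrees with the one at `e.symm (e k)` only up to a propositional equality,
      -- hence the transport.
      refine ⟨fun k => cast (congrArg M.carrier (congrArg y (e.symm_apply_apply k))) (b (e k)), ?_⟩
      funext k
      refine eq_of_heq ((cast_heq _ _).trans ?_)
      rw [e.apply_symm_apply]
    exact ⟨b, (hφ b).1 h⟩
  · rintro ⟨b, h⟩
    exact ⟨_, (hφ b).2 h⟩

/-! ### Finite support -/

/-- The second block `y` stays untouched because it will hold the bound variables of a formula. -/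
theorem Term.exists_finite_support {X : Type v} {x : X → L.Sorts} {K : Type w} {y : K → L.Sorts}
    {s : L.Sorts} (t : Term L (Sum.elim x y) s) :
    ∃ (W : Type) (_ : Finite W) (j : W → X) (t' : Term L (Sum.elim (fun k => x (j k)) y) s),
      ∀ (M : Str L) (a : Tuple M x) (b : Tuple M y),
        t.eval M (a.join b) =
          t'.eval M (Tuple.join (x := fun k => x (j k)) (fun k => a (j k)) b) := by
  induction t with
  | var i =>
    rcases i with i | k
    · exact ⟨Unit, inferInstance, fun _ => i,
        (Term.var (Sum.inl ()) : Term L (Sum.elim (fun _ : Unit => x i) y) (x i)),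
        fun _ _ _ => rfl⟩
    · exact ⟨Empty, inferInstance, Empty.elim,
        (Term.var (Sum.inr k) : Term L (Sum.elim (fun i : Empty => x i.elim) y) (y k)),
        fun _ _ _ => rfl⟩
  | app f ts ih =>
    choose W hW j t' ht' using ih
    refine ⟨Σ i, W i, inferInstance, fun p => j p.1 p.2, .app f (fun i => (t' i).subst (fun
      | Sum.inl k => (Term.var (Sum.inl (Sigma.mk i k)) :
          Term L (Sum.elim (fun p : Σ i, W i => x (j p.1 p.2)) y) (x (j i k)))
      | Sum.inr k => (Term.var (Sum.inr k) :
          Term L (Sum.elim (fun p : Σ i, W i => x (j p.1 p.2)) y) (y k)))), fun M a b => ?_⟩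
    simp only [Term.eval]
    congr 1
    funext i
    rw [ht', Term.eval_subst]
    congr 1
    funext k
    cases k <;> rfl

/-- Renaming of free variables, the bound variables being kept. -/
def renameFree {X : Type v} {Y : Type w} {y : Y → L.Sorts} (f : X → Y)
    {n : ℕ} {σ : Fin n → L.Sorts} :
    ∀ i, Term L (Sum.elim y σ) (Sum.elim (fun i => y (f i)) σ i)
  | Sum.inl i => (Term.var (Sum.inl (f i)) : Term L (Sum.elim y σ) (y (f i)))
  | Sum.inr k => (Term.var (Sum.inr k) : Term L (Sum.elim y σ) (σ k))

theorem BFormula.realize_renameFree (M : Str L) {X : Type v} {Y : Type w} {y : Y → L.Sorts}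
    (f : X → Y) {n : ℕ} {σ : Fin n → L.Sorts} (φ : BFormula L (fun i => y (f i)) n σ)
    (a : Tuple M y) (b : Tuple M σ) :
    (φ.subst (renameFree f)).Realize M a b ↔ φ.Realize M (fun i => a (f i)) b := by
  refine BFormula.realize_subst M φ _ _ _ _ _ ?_
  rintro (i | k) <;> rfl

theorem Term.eval_renameFree (M : Str L) {X : Type v} {Y : Type w} {y : Y → L.Sorts}
    (f : X → Y) {n : ℕ} {σ : Fin n → L.Sorts} {s : L.Sorts}
    (t : Term L (Sum.elim (fun i => y (f i)) σ) s)
    (a : Tuple M y) (b : Tuple M σ) :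
    (t.subst (renameFree f)).eval M (a.join b) =
      t.eval M (Tuple.join (x := fun i => y (f i)) (fun i => a (f i)) b) := by
  rw [Term.eval_subst]
  congr 1
  funext k
  cases k <;> rfl

theorem BFormula.exists_finite_support {X : Type v} {x : X → L.Sorts} {n : ℕ}
    {σ : Fin n → L.Sorts} (φ : BFormula L x n σ) :
    ∃ (W : Type) (_ : Finite W) (j : W → X) (φ' : BFormula L (fun k => x (j k)) n σ),
      ∀ (M : Str L) (a : Tuple M x) (b : Tuple M σ),
        φ.Realize M a b ↔ φ'.Realize M (fun k => a (j k)) b := by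
  induction φ with
  | falsum => exact ⟨Empty, inferInstance, Empty.elim, .falsum, fun _ _ _ => Iff.rfl⟩
  | equal t₁ t₂ =>
    obtain ⟨W₁, _, j₁, t₁', h₁⟩ := t₁.exists_finite_support
    obtain ⟨W₂, _, j₂, t₂', h₂⟩ := t₂.exists_finite_support
    refine ⟨W₁ ⊕ W₂, inferInstance, Sum.elim j₁ j₂,
      .equal (t₁'.subst (renameFree (y := fun k => x (Sum.elim j₁ j₂ k)) Sum.inl))
        (t₂'.subst (renameFree (y := fun k => x (Sum.elim j₁ j₂ k)) Sum.inr)), fun M a b => ?_⟩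
    simp only [BFormula.Realize, h₁, h₂]
    exact iff_of_eq (congrArg₂ _ (Term.eval_renameFree (y := fun k => x (Sum.elim j₁ j₂ k))
      M Sum.inl t₁' (fun k => a (Sum.elim j₁ j₂ k)) b).symm (Term.eval_renameFree (y := fun k => x (Sum.elim j₁ j₂ k))
      M Sum.inr t₂' (fun k => a (Sum.elim j₁ j₂ k)) b).symm)
  | rel R ts =>
    choose W hW j t' ht' using fun i => (ts i).exists_finite_support
    refine ⟨Σ i, W i, inferInstance, fun p => j p.1 p.2, .rel R (fun i =>
      (t' i).subst (renameFree (y := fun p : Σ i, W i => x (j p.1 p.2)) (Sigma.mk i))),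
      fun M a b => ?_⟩
    simp only [BFormula.Realize, ht']
    exact iff_of_eq (congrArg _ (funext fun i => (Term.eval_renameFree
      (y := fun p : Σ i, W i => x (j p.1 p.2)) M (Sigma.mk i) (t' i) (fun p => a (j p.1 p.2)) b).symm))
  | imp φ ψ ih₁ ih₂ =>
    obtain ⟨W₁, _, j₁, φ', h₁⟩ := ih₁
    obtain ⟨W₂, _, j₂, ψ', h₂⟩ := ih₂
    refine ⟨W₁ ⊕ W₂, inferInstance, Sum.elim j₁ j₂,
      .imp (φ'.subst (renameFree (y := fun k => x (Sum.elim j₁ j₂ k)) Sum.inl))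
        (ψ'.subst (renameFree (y := fun k => x (Sum.elim j₁ j₂ k)) Sum.inr)), fun M a b => ?_⟩
    simp only [BFormula.Realize, h₁, h₂]
    exact imp_congr (BFormula.realize_renameFree (y := fun k => x (Sum.elim j₁ j₂ k))
      M Sum.inl φ' (fun k => a (Sum.elim j₁ j₂ k)) b).symm (BFormula.realize_renameFree (y := fun k => x (Sum.elim j₁ j₂ k))
      M Sum.inr ψ' (fun k => a (Sum.elim j₁ j₂ k)) b).symm
  | all s φ ih =>
    obtain ⟨W, hW, j, φ', h⟩ := ih
    exact ⟨W, hW, j, .all s φ', fun M a b => forall_congr' fun m => h M a _⟩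

theorem Formula.exists_finite_support {X : Type v} {x : X → L.Sorts} (φ : Formula L x) :
    ∃ (W : Type) (_ : Finite W) (j : W → X) (φ' : Formula L (fun k => x (j k))),
      ∀ (M : Str L) (a : Tuple M x), φ.Holds M a ↔ φ'.Holds M (fun k => a (j k)) := by
  obtain ⟨W, hW, j, φ', h⟩ := BFormula.exists_finite_support φ
  exact ⟨W, hW, j, φ', fun M a => h M a _⟩

end Substitution


/-! ### Order patterns -/

/-- The map `g` numbers the values of `r` in increasing order. Strict comparisons determine
equalities in a linear order, so `r'` is constant on the fibres of `g` and increases with the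
number. -/
theorem exists_strictMono_factorization {I : Type u} [LinearOrder I] {K : Type v} [Finite K]
    (r r' : K → I) (h : ∀ k l, r k < r l ↔ r' k < r' l) :
    ∃ (m : ℕ) (g : K → Fin m) (i i' : Fin m → I), g.Surjective ∧ StrictMono i ∧ StrictMono i' ∧
      (∀ k, r k = i (g k)) ∧ ∀ k, r' k = i' (g k) := by
  classical
  have := Fintype.ofFinite K
  let S : Finset I := Finset.univ.image r
  let E := S.orderIsoOfFin rfl
  have hS : ∀ k, r k ∈ S := fun k => Finset.mem_image_of_mem _ (Finset.mem_univ k)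
  let g : K → Fin S.card := fun k => E.symm ⟨r k, hS k⟩
  have hE : ∀ k, (E (g k) : I) = r k := fun k => by simp [g]
  have hsurj : ∀ m, ∃ k, g k = m := by
    intro m
    obtain ⟨k, -, hk⟩ := Finset.mem_image.1 (E m).2
    refine ⟨k, ?_⟩
    simp only [g, hk]
    exact E.symm_apply_apply m
  have hsurj' : g.Surjective := hsurj
  choose f hf using hsurj
  refine ⟨S.card, g, fun m => E m, fun m => r' (f m), hsurj', fun m n hmn => E.strictMono hmn,
    fun m n hmn => ?_, fun k => (hE k).symm, fun k => ?_⟩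
  · rw [← h, ← hE, ← hE, hf, hf]
    exact E.strictMono hmn
  · have heq : r (f (g k)) = r k := by rw [← hE, ← hE, hf]
    have h₁ := (h (f (g k)) k).not.1 heq.not_lt
    have h₂ := (h k (f (g k))).not.1 heq.symm.not_lt
    exact le_antisymm (not_lt.1 h₁) (not_lt.1 h₂)

theorem exists_strictMono_into {K : Type v} [Finite K] [LinearOrder K] {I : Type u} [LinearOrder I]
    {B : Set I} (hB : B.Infinite) : ∃ ρ : K → I, StrictMono ρ ∧ ∀ k, ρ k ∈ B := by
  have := Fintype.ofFinite K
  obtain ⟨S, hSB, hS⟩ := hB.exists_subset_card_eq (Fintype.card K)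
  let E := S.orderIsoOfFin hS
  let E' := (Fintype.orderIsoFinOfCardEq K rfl).symm
  exact ⟨fun k => E (E' k), fun k l hkl => E.strictMono (E'.strictMono hkl), fun k => hSB (E _).2⟩

/-! ### Indiscernibility in terms of order patterns -/

section Indiscernible

variable {L : Language.{u}} {M : Str L}

/-- Indices may repeat and come in any order: identifying the variables with equal index reduces
this to increasing tuples. -/
theorem IndiscernibleOver.holds_iff {X : Type} {x : X → L.Sorts} {I : Type u} [LinearOrder I]
    {a : I → Tuple M x} {J : Set I} {P : Type v} {p : P → L.Sorts} {e : Tuple M p}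
    (ha : IndiscernibleOver a J e) {K : Type w} [Finite K] (r r' : K → I)
    (hr : ∀ k, r k ∈ J) (hr' : ∀ k, r' k ∈ J) (h : ∀ k l, r k < r l ↔ r' k < r' l)
    (φ : Formula L (Sum.elim (fun q : K × X => x q.2) p)) :
    φ.Holds M (Tuple.join (x := fun q : K × X => x q.2) (fun q => a (r q.1) q.2) e) ↔
      φ.Holds M (Tuple.join (x := fun q : K × X => x q.2) (fun q => a (r' q.1) q.2) e) := by
  obtain ⟨m, g, i, i', hgs, hi, hi', hg, hg'⟩ := exists_strictMono_factorization r r' h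
  let y : (Fin m × X) ⊕ P → L.Sorts := Sum.elim (fun q : Fin m × X => x q.2) p
  let θ : ∀ k, Term L y (Sum.elim (fun q : K × X => x q.2) p k) := fun
    | Sum.inl q => (Term.var (Sum.inl (g q.1, q.2)) : Term L y (x q.2))
    | Sum.inr k => (Term.var (Sum.inr k) : Term L y (p k))
  have hθ : ∀ s : Fin m → I, (fun k => (θ k).eval M (Tuple.join
      (x := fun q : Fin m × X => x q.2) (fun q => a (s q.1) q.2) e)) =
      Tuple.join (x := fun q : K × X => x q.2) (fun q => a (s (g q.1)) q.2) e := by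
    intro s
    funext k
    cases k <;> rfl
  have key := ha m (φ.subst θ) i i' hi hi'
    (fun k => by obtain ⟨k, rfl⟩ := hgs k; rw [← hg]; exact hr k)
    (fun k => by obtain ⟨k, rfl⟩ := hgs k; rw [← hg']; exact hr' k)
  rw [Formula.holds_subst, Formula.holds_subst, hθ, hθ] at key
  simpa only [hg, hg'] using key

theorem IndiscernibleOver.of_terms {X : Type} {x : X → L.Sorts} {I : Type u} [LinearOrder I]
    {a : I → Tuple M x} {J : Set I} {P : Type v} {p : P → L.Sorts} {e : Tuple M p}
    (ha : IndiscernibleOver a J e) {Q : Type w} {q : Q → L.Sorts} {e' : Tuple M q}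
    (h : ∀ k, ∃ τ : Term L p (q k), e' k = τ.eval M e) : IndiscernibleOver a J e' := by
  choose τ hτ using h
  intro n φ i j hi hj hiJ hjJ
  let θ : ∀ k, Term L (Sum.elim (fun k : Fin n × X => x k.2) p)
      (Sum.elim (fun k : Fin n × X => x k.2) q k) := fun
    | Sum.inl k => (Term.var (Sum.inl k) : Term L (Sum.elim (fun k : Fin n × X => x k.2) p) (x k.2))
    | Sum.inr k => (τ k).subst (fun l => (Term.var (Sum.inr l) :
        Term L (Sum.elim (fun k : Fin n × X => x k.2) p) (p l)))
  have := ha n (φ.subst θ) i j hi hj hiJ hjJ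
  have e₁ : ∀ b : Tuple M (fun k : Fin n × X => x k.2),
      (fun k => (θ k).eval M (b.join e)) = b.join e' := by
    intro b
    funext k
    rcases k with k | k
    · rfl
    · exact (Term.eval_subst M _ _ (τ k)).trans (hτ k).symm
  rw [Formula.holds_subst, Formula.holds_subst, e₁, e₁] at this
  exact this

end Indiscernible

/-! ### Saturation and compactness -/

section Compactness

variable {L : Language.{u}}

theorem Term.exists_var_of_inCoords {M : Str L} {P : Type v} {p : P → L.Sorts} {e : Tuple M p}
    {s : L.Sorts} {m : M s} (h : InCoords e s m) : ∃ τ : Term L p s, m = τ.eval M e := by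
  cases h with
  | coord k => exact ⟨Term.var k, rfl⟩

theorem Tuple.finite_coords_elems {M : Str L} {P : Type v} [Finite P] {p : P → L.Sorts}
    (e : Tuple M p) : Finite e.coords.Elems := by
  refine Finite.of_surjective (fun k : P => (⟨p k, e k, InCoords.coord k⟩ : e.coords.Elems)) ?_
  rintro ⟨s, m, h⟩
  cases h with
  | coord k => exact ⟨k, rfl⟩

/-- Saturation is stated for sets of parameters. A finite tuple, possibly with repetitions, is
replaced by its finite set of coordinates. -/
theorem Str.IsSaturated.exists_tuple {U : Str L} {κ : Cardinal.{u}} (hU : U.IsSaturated κ)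
    (hκ : Cardinal.aleph0 ≤ κ) {P : Type v} [Finite P] {p : P → L.Sorts} (e : Tuple U p)
    {X : Type} [Finite X] {x : X → L.Sorts} (Φ : Set (Formula L (Sum.elim x p)))
    (hΦ : ∀ Φ₀ ⊆ Φ, Φ₀.Finite → ∃ a : Tuple U x, ∀ φ ∈ Φ₀, φ.Holds U (a.join e)) :
    ∃ a : Tuple U x, ∀ φ ∈ Φ, φ.Holds U (a.join e) := by
  have := e.finite_coords_elems
  let θ : ∀ k, Term L (Sum.elim x e.coords.elemSort) (Sum.elim x p k) := fun
    | Sum.inl i => (Term.var (Sum.inl i) : Term L (Sum.elim x e.coords.elemSort) (x i))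
    | Sum.inr k => (Term.var (Sum.inr (Sigma.mk (p k) (Subtype.mk (e k) (InCoords.coord k)))) :
        Term L (Sum.elim x e.coords.elemSort) (p k))
  have hθ : ∀ (φ : Formula L (Sum.elim x p)) (a : Tuple U x),
      (φ.subst θ).Holds U (a.join e.coords.elemVal) ↔ φ.Holds U (a.join e) := by
    intro φ a
    rw [Formula.holds_subst]
    rw [show (fun k => (θ k).eval U (a.join e.coords.elemVal)) = a.join e by
      funext k; cases k <;> rfl]
  obtain ⟨a, ha⟩ := hU e.coords ((Cardinal.mk_lt_aleph0_iff.2 this).trans_le hκ) X x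
    ((fun φ => φ.subst θ) '' Φ) (by
      intro Φ₀ hΦ₀ hfin
      have : Nonempty (Formula L (Sum.elim x p)) := ⟨(Formula.exists_true _).choose⟩
      choose! f hf using hΦ₀
      obtain ⟨a, ha⟩ := hΦ (f '' Φ₀) (by rintro _ ⟨φ, hφ, rfl⟩; exact (hf hφ).1) (hfin.image f)
      refine ⟨a, fun φ hφ => ?_⟩
      rw [← (hf hφ).2]
      exact (hθ _ a).2 (ha _ ⟨φ, hφ, rfl⟩))
  exact ⟨a, fun φ hφ => (hθ φ a).1 (ha _ ⟨φ, hφ, rfl⟩)⟩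

/-- Even for infinite `V` the condition is first-order, since only the finitely many variables in
the support of `φ` need a quantifier. -/
theorem Formula.exists_extension {V : Type v} {x : V → L.Sorts} (φ : Formula L x) (K : Set V) :
    ∃ χ : Formula L (fun k : K => x k), ∀ (M : Str L), (∀ k, Nonempty (M (x k))) →
      ∀ a : Tuple M (fun k : K => x k),
        χ.Holds M a ↔ ∃ b : Tuple M x, (∀ k : K, b k = a k) ∧ φ.Holds M b := by
  classical
  obtain ⟨W, _, j, φ', hφ'⟩ := φ.exists_finite_support
  let y : K ⊕ Set.range j → L.Sorts := Sum.elim (fun k : K => x k) (fun k => x k)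
  have : ∀ w, ∃ t : Term L y (x (j w)), ∀ (M : Str L) (a : Tuple M (fun k : K => x k))
      (b : Tuple M (fun k : Set.range j => x k)),
      (∀ h : j w ∈ K, t.eval M (a.join b) = a ⟨j w, h⟩) ∧
      (j w ∉ K → t.eval M (a.join b) = b ⟨j w, w, rfl⟩) := by
    intro w
    by_cases h : j w ∈ K
    · exact ⟨(Term.var (Sum.inl (Subtype.mk (j w) h)) : Term L y (x (j w))),
        fun M a b => ⟨fun _ => rfl, fun h' => (h' h).elim⟩⟩
    · exact ⟨(Term.var (Sum.inr (Subtype.mk (j w) (Set.mem_range_self w))) : Term L y (x (j w))),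
        fun M a b => ⟨fun h' => (h h').elim, fun _ => rfl⟩⟩
  choose τ hτ using this
  obtain ⟨χ, hχ⟩ := Formula.exists_exists (x := fun k : K => x k)
    (y := fun k : Set.range j => x k) (φ'.subst τ)
  refine ⟨χ, fun M hM a => (hχ M a).trans ?_⟩
  simp only [hφ']
  constructor
  · rintro ⟨b, h⟩
    replace h := (Formula.holds_subst M _ φ' _).1 h
    -- Variables outside both `K` and the support receive arbitrary values; this is where empty
    -- sorts must be excluded.
    refine ⟨fun k => if h : k ∈ K then a ⟨k, h⟩ else if h : k ∈ Set.range j then b ⟨k, h⟩ else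
      (hM k).some, fun k => by simp, ?_⟩
    convert h using 1
    funext w
    by_cases h : j w ∈ K
    · simp only [dif_pos h]; exact ((hτ w M a b).1 h).symm
    · simp only [dif_neg h, Set.mem_range_self, dif_pos]; exact ((hτ w M a b).2 h).symm
  · rintro ⟨b, hb, h⟩
    refine ⟨fun k => b k, (Formula.holds_subst M _ φ' _).2 ?_⟩
    convert h using 1
    funext w
    by_cases h : j w ∈ K
    · exact ((hτ w M a _).1 h).trans (hb ⟨_, h⟩).symm
    · exact (hτ w M a _).2 h

theorem Theory.IsComplete.holds_iff {T : Theory L} (hT : T.IsComplete) {M N : Str L}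
    (hM : M.Models T) (hN : N.Models T) (φ : Sentence L) :
    φ.Holds M Tuple.nil ↔ φ.Holds N Tuple.nil := by
  rcases hT.2 φ with h | h
  · exact iff_of_true (h M hM) (h N hN)
  · exact iff_of_false (h M hM) (h N hN)

theorem Theory.IsComplete.nonempty {T : Theory L} (hT : T.IsComplete) {M N : Str L}
    (hM : M.Models T) (hN : N.Models T) {s : L.Sorts} (h : Nonempty (M s)) : Nonempty (N s) := by
  obtain ⟨φ, hφ⟩ := Formula.exists_true
    (Sum.elim (Empty.elim : Empty → L.Sorts) (fun _ : Unit => s))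
  obtain ⟨χ, hχ⟩ := Formula.exists_exists_single φ
  obtain ⟨m, -⟩ := (hχ N _).1 ((hT.holds_iff hM hN χ).1
    ((hχ M _).2 ⟨h.some, hφ M _⟩))
  exact ⟨m⟩

/-- Quantifying all variables in the support leaves a sentence, which completeness transfers. The
remaining variables can be filled in `N` because nonemptiness of a sort is itself expressed by a
sentence. -/
theorem Theory.IsComplete.exists_holds {T : Theory L} (hT : T.IsComplete) {M N : Str L}
    (hM : M.Models T) (hN : N.Models T) {V : Type v} {x : V → L.Sorts} {φ : Formula L x}
    (h : ∃ a, φ.Holds M a) : ∃ a, φ.Holds N a := by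
  obtain ⟨a, ha⟩ := h
  have hMne : ∀ k, Nonempty (M (x k)) := fun k => ⟨a k⟩
  obtain ⟨χ, hχ⟩ := φ.exists_extension ∅
  let χ' : Sentence L := χ.subst (fun k => k.2.elim)
  have hχ' : ∀ (N : Str L) (b : Tuple N (fun k : (∅ : Set V) => x k)),
      χ'.Holds N Tuple.nil ↔ χ.Holds N b := by
    intro N b
    refine (Formula.holds_subst N _ χ _).trans ?_
    rw [show (fun i : (∅ : Set V) => Term.eval N Tuple.nil (i.2.elim :
      Term L (Empty.elim : Empty → L.Sorts) (x i))) = b from funext fun k => k.2.elim]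
  have h₁ := (hχ' M _).2 ((hχ M hMne fun k => k.2.elim).2 ⟨a, fun k => k.2.elim, ha⟩)
  have h₂ := (hχ' N fun k => k.2.elim).1 ((hT.holds_iff hM hN χ').1 h₁)
  obtain ⟨b, -, hb⟩ := (hχ N (fun k => hT.nonempty hM hN (hMne k)) _).1 h₂
  exact ⟨b, hb⟩

/-- The tuple `a` can be kept on `K` while satisfying any finite part of `Φ`. -/
def FinSatOver {U : Str L} {V : Type v} {x : V → L.Sorts} (Φ : Set (Formula L x)) (K : Set V)
    (a : Tuple U x) : Prop :=
  ∀ Φ₀ ⊆ Φ, Φ₀.Finite → ∃ b : Tuple U x, (∀ k ∈ K, b k = a k) ∧ ∀ φ ∈ Φ₀, φ.Holds U b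

/-- For finite `Φ₀`, it is a formula in `c`, with the finitely many parameters `a k` for `k ∈ K`,
that some solution of `Φ₀` agrees with `a` on `K` and has value `c` at `k₀`. Finitely many of these
formulas are realized together, by a solution of the union of their sets `Φ₀`. Saturation in one
variable gives a `c` that suits all of them. -/
theorem FinSatOver.exists_insert {U : Str L} {κ : Cardinal.{u}} (hU : U.IsSaturated κ)
    (hκ : Cardinal.aleph0 ≤ κ) {V : Type v} {x : V → L.Sorts} {Φ : Set (Formula L x)}
    {K : Set V} (hK : K.Finite) {a : Tuple U x} (ha : FinSatOver Φ K a) (k₀ : V) :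
    ∃ a' : Tuple U x, (∀ k ∈ K, a' k = a k) ∧ FinSatOver Φ (insert k₀ K) a' := by
  classical
  by_cases hk₀ : k₀ ∈ K
  · exact ⟨a, fun _ _ => rfl, by rwa [Set.insert_eq_of_mem hk₀]⟩
  have := hK.to_subtype
  have hne : ∀ k, Nonempty (U (x k)) := fun k => ⟨a k⟩
  let y : Unit ⊕ K → L.Sorts := Sum.elim (fun _ => x k₀) (fun k => x k)
  have hψ : ∀ Φ₀ : Set (Formula L x), ∃ ψ : Formula L y, Φ₀.Finite → ∀ c : U (x k₀),
      (ψ.Holds U (Tuple.join (x := fun _ : Unit => x k₀) (y := fun k : K => x k)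
        (fun _ => c) (fun k => a k)) ↔
        ∃ b : Tuple U x, b k₀ = c ∧ (∀ k ∈ K, b k = a k) ∧ ∀ φ ∈ Φ₀, φ.Holds U b) := by
    intro Φ₀
    by_cases hfin : Φ₀.Finite
    swap
    · exact ⟨(Formula.exists_true y).choose, fun h => (hfin h).elim⟩
    obtain ⟨χ, hχ⟩ := Formula.exists_conj hfin
    obtain ⟨ξ, hξ⟩ := χ.exists_extension (insert k₀ K)
    have : ∀ k : (insert k₀ K : Set V), ∃ t : Term L y (x k), ∀ b : Tuple U x,
        t.eval U (Tuple.join (x := fun _ : Unit => x k₀) (y := fun k : K => x k)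
          (fun _ => b k₀) (fun k => b k)) = b k := by
      rintro ⟨k, rfl | hk⟩
      · exact ⟨(Term.var (Sum.inl ()) : Term L y (x k)), fun _ => rfl⟩
      · exact ⟨(Term.var (Sum.inr (Subtype.mk k hk)) : Term L y (x k)), fun _ => rfl⟩
    choose τ hτ using this
    refine ⟨ξ.subst τ, fun _ c => ?_⟩
    rw [Formula.holds_subst]
    have e₁ : (fun i => (τ i).eval U (Tuple.join (x := fun _ : Unit => x k₀)
        (y := fun k : K => x k) (fun _ => c) (fun k => a k))) =
        fun k : (insert k₀ K : Set V) => Function.update a k₀ c k := by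
      funext k
      rw [← hτ k (Function.update a k₀ c)]
      congr 2
      · simp
      · funext l
        exact (Function.update_of_ne (fun h => hk₀ (by rw [← h]; exact l.2)) _ _).symm
    rw [e₁, hξ U hne]
    refine exists_congr fun b => ?_
    rw [hχ, ← and_assoc]
    refine and_congr_left fun _ => ?_
    constructor
    · intro h
      refine ⟨(h ⟨k₀, Set.mem_insert _ _⟩).trans (by simp), fun k hk => ?_⟩
      exact (h ⟨k, Set.mem_insert_of_mem _ hk⟩).trans
        (Function.update_of_ne (fun h => hk₀ (by rwa [← h])) _ _)
    · rintro ⟨h₀, h⟩ ⟨k, rfl | hk⟩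
      · simpa using h₀
      · exact (h k hk).trans (Function.update_of_ne (fun h => hk₀ (by rwa [← h])) _ _).symm
  choose ψ hψ using hψ
  obtain ⟨c, hc⟩ := hU.exists_tuple hκ (fun k : K => a k) (x := fun _ : Unit => x k₀)
    (ψ '' {Φ₀ | Φ₀ ⊆ Φ ∧ Φ₀.Finite}) (by
      intro Ψ hΨ hfin
      have : ∀ ξ : Formula L y, ∃ Φ₀ : Set (Formula L x), ξ ∈ Ψ →
          (Φ₀ ⊆ Φ ∧ Φ₀.Finite) ∧ ψ Φ₀ = ξ := by
        intro ξ
        by_cases hξ : ξ ∈ Ψ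
        · exact (hΨ hξ).imp fun _ h _ => h
        · exact ⟨∅, fun h => (hξ h).elim⟩
      choose f hf using this
      obtain ⟨b, hb, hbΦ⟩ := ha (⋃ φ ∈ Ψ, f φ) (Set.iUnion₂_subset fun φ hφ => (hf φ hφ).1.1)
        (hfin.biUnion fun φ hφ => (hf φ hφ).1.2)
      refine ⟨fun _ => b k₀, fun φ hφ => ?_⟩
      have h₁ := (hψ (f φ) (hf φ hφ).1.2 (b k₀)).2
        ⟨b, rfl, hb, fun χ hχ => hbΦ χ (Set.mem_biUnion hφ hχ)⟩
      rw [(hf φ hφ).2] at h₁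
      exact h₁)
  refine ⟨Function.update a k₀ (c ()), fun k hk =>
    Function.update_of_ne (fun h => hk₀ (by rwa [← h])) _ _, fun Φ₀ hΦ₀ hfin => ?_⟩
  obtain ⟨b, hb₀, hb, hbΦ⟩ := (hψ Φ₀ hfin (c ())).1 (hc _ ⟨Φ₀, ⟨hΦ₀, hfin⟩, rfl⟩)
  refine ⟨b, ?_, hbΦ⟩
  rintro k (rfl | hk)
  · simpa using hb₀
  · exact (hb k hk).trans (Function.update_of_ne (fun h => hk₀ (by rwa [← h])) _ _).symm

/-- Saturation handles finite multivariables. For countably many variables, the values are fixed one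
at a time along an enumeration, preserving finite satisfiability; the limit works because a formula
sees only finitely many variables. -/
theorem Str.IsSaturated.exists_realization {U : Str L} {κ : Cardinal.{u}} (hU : U.IsSaturated κ)
    (hκ : Cardinal.aleph0 ≤ κ) {V : Type v} [Countable V] {x : V → L.Sorts}
    (Φ : Set (Formula L x))
    (hΦ : ∀ Φ₀ ⊆ Φ, Φ₀.Finite → ∃ a : Tuple U x, ∀ φ ∈ Φ₀, φ.Holds U a) :
    ∃ a : Tuple U x, ∀ φ ∈ Φ, φ.Holds U a := by
  obtain ⟨enc, henc⟩ := Countable.exists_injective_nat V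
  have hK : ∀ n, {k | enc k < n}.Finite := fun n =>
    (Set.finite_Iio n).preimage henc.injOn
  have step : ∀ (n : ℕ) (a : Tuple U x), ∃ a' : Tuple U x, FinSatOver Φ {k | enc k < n} a →
      (∀ k, enc k < n → a' k = a k) ∧ FinSatOver Φ {k | enc k < n + 1} a' := by
    intro n a
    by_cases ha : FinSatOver Φ {k | enc k < n} a
    swap
    · exact ⟨a, fun h => (ha h).elim⟩
    by_cases h : ∃ k₀, enc k₀ = n
    · obtain ⟨k₀, hk₀⟩ := h
      obtain ⟨a', h₁, h₂⟩ := ha.exists_insert hU hκ (hK n) k₀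
      refine ⟨a', fun _ => ⟨h₁, ?_⟩⟩
      convert h₂ using 1
      ext k
      simp only [Set.mem_ofPred_eq, Set.mem_insert_iff, Nat.lt_succ_iff_lt_or_eq]
      rw [← henc.eq_iff, hk₀, or_comm]
    · refine ⟨a, fun _ => ⟨fun _ _ => rfl, ?_⟩⟩
      convert ha using 1
      ext k
      simp only [Set.mem_ofPred_eq, Nat.lt_succ_iff_lt_or_eq]
      exact or_iff_left fun hk => h ⟨k, hk⟩
  choose next hnext using step
  obtain ⟨a₀, -⟩ := hΦ ∅ (Set.empty_subset _) Set.finite_empty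
  let seq : ℕ → Tuple U x := fun n => Nat.rec a₀ next n
  have hseq : ∀ n, FinSatOver Φ {k | enc k < n} (seq n) := by
    intro n
    induction n with
    | zero =>
      intro Φ₀ h₁ h₂
      obtain ⟨b, hb⟩ := hΦ Φ₀ h₁ h₂
      exact ⟨b, fun k hk => (Nat.not_lt_zero _ hk).elim, hb⟩
    | succ n ih => exact (hnext n (seq n) ih).2
  have hstab : ∀ m n, n ≤ m → ∀ k, enc k < n → seq m k = seq n k := by
    intro m n hmn k hk
    induction m, hmn using Nat.le_induction with
    | base => rfl
    | succ m hm ih => rw [← ih]; exact (hnext m (seq m) (hseq m)).1 k (hk.trans_le hm)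
  -- The value of `k` is fixed when passing to stage `enc k + 1` and never changes afterwards.
  refine ⟨fun k => seq (enc k + 1) k, fun φ hφ => ?_⟩
  obtain ⟨W, _, j, φ', hφ'⟩ := φ.exists_finite_support
  obtain ⟨N, hN⟩ : ∃ N, ∀ w, enc (j w) < N := by
    obtain ⟨N, hN⟩ := (Set.finite_range fun w => enc (j w)).bddAbove
    exact ⟨N + 1, fun w => Nat.lt_succ_of_le (hN ⟨w, rfl⟩)⟩
  obtain ⟨b, hb, hbφ⟩ := hseq N {φ} (by simpa using hφ) (Set.finite_singleton φ)
  have h₁ := hbφ φ rfl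
  rw [hφ'] at h₁ ⊢
  convert h₁ using 1
  funext w
  rw [hb _ (hN w)]
  exact (hstab N _ (hN w) _ (Nat.lt_succ_self _)).symm

end Compactness


/-! ### Stretching a sequence around an inserted element -/

/-- Pigeonhole: off the range of `i`, the points of `B` determine only finitely many cuts in it. -/
theorem exists_infinite_same_cut {I : Type u} [LinearOrder I] {B : Set I} (hB : B.Infinite)
    {n : ℕ} (i : Fin n → I) :
    ∃ (S : Set I) (A : Set (Fin n)), S ⊆ B ∧ S.Infinite ∧
      ∀ s ∈ S, (∀ m ∈ A, i m < s) ∧ ∀ m ∉ A, s < i m := by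
  have hB' : (B \ Set.range i).Infinite := hB.sdiff (Set.finite_range i)
  have := hB'.to_subtype
  obtain ⟨A, hA⟩ := Finite.exists_infinite_fiber
    (fun s : (B \ Set.range i : Set I) => {m | i m < s})
  refine ⟨Subtype.val '' ((fun s : (B \ Set.range i : Set I) => {m | i m < s}) ⁻¹' {A}), A,
    ?_, ?_, ?_⟩
  · rintro _ ⟨s, -, rfl⟩
    exact s.2.1
  · exact (Set.infinite_coe_iff.1 hA).image Subtype.val_injective.injOn
  · rintro _ ⟨s, rfl, rfl⟩
    refine ⟨fun m hm => hm, fun m hm => lt_of_le_of_ne (not_lt.1 hm) fun h => s.2.2 ⟨m, h.symm⟩⟩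

/-- One tuple `i` through `c` becomes a family of tuples `R q` with `R z = i`. The entries near `c`
move to an infinite set on the left for `q < z` and on the right for `q > z`, while the others stay
fixed. Comparisons between blocks then depend only on comparisons between their labels, which makes
the blocks indiscernible. Neither side of `c` needs to lack an extremal element. -/
theorem exists_stretch {I : Type u} [LinearOrder I] {c : I} (hI₁ : (Set.Iio c).Infinite)
    (hI₂ : (Set.Ioi c).Infinite) {n : ℕ} {i : Fin n → I} (hi : StrictMono i)
    {Q : Type v} [LinearOrder Q] (z : Q) :
    ∃ mid : Fin n → Prop, ∀ S : Set Q, S.Finite → ∃ R : Q → Fin n → I, R z = i ∧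
      (∀ q ∈ S, ∀ q' ∈ S, ∀ m m', R q m < R q' m' ↔
        (mid m ∧ mid m' ∧ (q < q' ∨ q = q' ∧ m < m')) ∨ (¬ (mid m ∧ mid m') ∧ m < m')) ∧
      ∀ q ∈ S, q ≠ z → ∀ m, R q m ≠ c := by
  classical
  obtain ⟨S₁, A₁, hS₁, hS₁inf, hA₁⟩ := exists_infinite_same_cut hI₁ i
  obtain ⟨S₂, A₂, hS₂, hS₂inf, hA₂⟩ := exists_infinite_same_cut hI₂ i
  have h₁₂ : ∀ s₁ ∈ S₁, ∀ s₂ ∈ S₂, s₁ < s₂ := fun s₁ h₁ s₂ h₂ =>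
    lt_trans (hS₁ h₁) (hS₂ h₂)
  obtain ⟨t₁, ht₁⟩ := hS₁inf.nonempty
  obtain ⟨t₂, ht₂⟩ := hS₂inf.nonempty
  have hc : ∀ m, i m = c → m ∉ A₁ ∧ m ∈ A₂ := by
    rintro m rfl
    refine ⟨fun h => lt_asymm ((hA₁ t₁ ht₁).1 m h) (hS₁ ht₁), ?_⟩
    by_contra h
    exact lt_asymm ((hA₂ t₂ ht₂).2 m h) (hS₂ ht₂)
  -- The movable positions: those whose entry lies above `S₁` and below `S₂`. Any position with
  -- entry `c` is among them.
  let mid : Fin n → Prop := fun m => m ∉ A₁ ∧ m ∈ A₂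
  refine ⟨mid, fun S hS => ?_⟩
  have := hS.to_subtype
  have : Finite (S ×ₗ Fin n) := inferInstanceAs (Finite (S × Fin n))
  -- The lexicographic order places the movable parts of the blocks one after the other, in the
  -- order of their labels.
  obtain ⟨ρ₁, hρ₁, hρ₁S⟩ := exists_strictMono_into (K := S ×ₗ Fin n) hS₁inf
  obtain ⟨ρ₂, hρ₂, hρ₂S⟩ := exists_strictMono_into (K := S ×ₗ Fin n) hS₂inf
  let R : Q → Fin n → I := fun q m => if q = z then i m else if h : q ∈ S ∧ mid m then
    (if q < z then ρ₁ (toLex (⟨q, h.1⟩, m)) else ρ₂ (toLex (⟨q, h.1⟩, m))) else i m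
  have hRz : ∀ m, R z m = i m := fun m => if_pos rfl
  have hRn : ∀ q m, ¬ mid m → R q m = i m := fun q m hm => by simp [R, hm]
  have hR₁ : ∀ q (h : q ∈ S) m, mid m → q < z → R q m = ρ₁ (toLex (⟨q, h⟩, m)) :=
    fun q h m hm hq => by simp [R, hm, h, hq, hq.ne]
  have hR₂ : ∀ q (h : q ∈ S) m, mid m → z < q → R q m = ρ₂ (toLex (⟨q, h⟩, m)) :=
    fun q h m hm hq => by simp [R, hm, h, hq.ne', hq.not_gt]
  have hlow : ∀ q ∈ S, ∀ m, mid m → ∀ m' ∈ A₁, i m' < R q m := by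
    intro q hq m hm m' hm'
    rcases lt_trichotomy q z with h | rfl | h
    · rw [hR₁ q hq m hm h]
      exact (hA₁ _ (hρ₁S _)).1 m' hm'
    · rw [hRz]
      exact ((hA₁ t₁ ht₁).1 m' hm').trans ((hA₁ t₁ ht₁).2 m hm.1)
    · rw [hR₂ q hq m hm h]
      exact ((hA₁ t₁ ht₁).1 m' hm').trans (h₁₂ _ ht₁ _ (hρ₂S _))
  have hhigh : ∀ q ∈ S, ∀ m, mid m → ∀ m' ∉ A₂, R q m < i m' := by
    intro q hq m hm m' hm'
    rcases lt_trichotomy q z with h | rfl | h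
    · rw [hR₁ q hq m hm h]
      exact (h₁₂ _ (hρ₁S _) _ ht₂).trans ((hA₂ t₂ ht₂).2 m' hm')
    · rw [hRz]
      exact ((hA₂ t₂ ht₂).1 m hm.2).trans ((hA₂ t₂ ht₂).2 m' hm')
    · rw [hR₂ q hq m hm h]
      exact (hA₂ _ (hρ₂S _)).2 m' hm'
  have hlow' : ∀ m, mid m → ∀ m' ∈ A₁, m' < m := fun m hm m' hm' =>
    hi.lt_iff_lt.1 (((hA₁ t₁ ht₁).1 m' hm').trans ((hA₁ t₁ ht₁).2 m hm.1))
  have hhigh' : ∀ m, mid m → ∀ m' ∉ A₂, m < m' := fun m hm m' hm' =>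
    hi.lt_iff_lt.1 (((hA₂ t₂ ht₂).1 m hm.2).trans ((hA₂ t₂ ht₂).2 m' hm'))
  have hnot : ∀ m, ¬ mid m → m ∈ A₁ ∨ m ∉ A₂ := fun m hm => by
    by_contra! h
    exact hm h
  refine ⟨R, funext hRz, fun q hq q' hq' m m' => ?_, fun q hq hqz m => ?_⟩
  · by_cases hm : mid m
    · by_cases hm' : mid m'
      · simp only [hm, hm', true_and, and_self, not_true, false_and, or_false]
        rcases lt_trichotomy q z with h | h | h <;> rcases lt_trichotomy q' z with h' | h' | h'
        · rw [hR₁ q hq m hm h, hR₁ q' hq' m' hm' h', hρ₁.lt_iff_lt, Prod.Lex.toLex_lt_toLex]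
          simp
        · rw [hR₁ q hq m hm h, h', hRz]
          exact iff_of_true ((hA₁ _ (hρ₁S _)).2 m' hm'.1) (Or.inl h)
        · rw [hR₁ q hq m hm h, hR₂ q' hq' m' hm' h']
          exact iff_of_true (h₁₂ _ (hρ₁S _) _ (hρ₂S _)) (Or.inl (h.trans h'))
        · rw [hR₁ q' hq' m' hm' h', h, hRz]
          exact iff_of_false ((hA₁ _ (hρ₁S _)).2 m hm.1).not_gt
            (by rintro (h | ⟨h, -⟩) <;> order)
        · rw [h, h', hRz, hRz, hi.lt_iff_lt]
          simp
        · rw [hR₂ q' hq' m' hm' h', h, hRz]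
          exact iff_of_true ((hA₂ _ (hρ₂S _)).1 m hm.2) (Or.inl h')
        · rw [hR₂ q hq m hm h, hR₁ q' hq' m' hm' h']
          exact iff_of_false (h₁₂ _ (hρ₁S _) _ (hρ₂S _)).not_gt
            (by rintro (h | ⟨h, -⟩) <;> order)
        · rw [hR₂ q hq m hm h, h', hRz]
          exact iff_of_false ((hA₂ _ (hρ₂S _)).1 m' hm'.2).not_gt
            (by rintro (h | ⟨h, -⟩) <;> order)
        · rw [hR₂ q hq m hm h, hR₂ q' hq' m' hm' h', hρ₂.lt_iff_lt, Prod.Lex.toLex_lt_toLex]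
          simp
      · simp only [hm, hm', and_false, false_and, not_false_eq_true, true_and, false_or]
        rw [hRn q' m' hm']
        rcases hnot m' hm' with h | h
        · exact iff_of_false (hlow q hq m hm m' h).not_gt (hlow' m hm m' h).not_gt
        · exact iff_of_true (hhigh q hq m hm m' h) (hhigh' m hm m' h)
    · simp only [hm, false_and, not_false_eq_true, true_and, false_or]
      rw [hRn q m hm]
      by_cases hm' : mid m'
      · rcases hnot m hm with h | h
        · exact iff_of_true (hlow q' hq' m' hm' m h) (hlow' m' hm' m h)
        · exact iff_of_false (hhigh q' hq' m' hm' m h).not_gt (hhigh' m' hm' m h).not_gt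
      · rw [hRn q' m' hm', hi.lt_iff_lt]
  · by_cases hm : mid m
    · rcases lt_or_gt_of_ne hqz with h | h
      · rw [hR₁ q hq m hm h]
        exact (hS₁ (hρ₁S _)).ne
      · rw [hR₂ q hq m hm h]
        exact (hS₂ (hρ₂S _)).ne'
    · rw [hRn q m hm]
      exact fun h => hm (hc m h)

/-- The tuples given by `exists_stretch` realize every finite part of the required type in `M`.
Completeness carries the finite parts over to `U`, and saturation in countably many variables
realizes the whole type there. -/
theorem exists_stretched_sequence {L : Language.{u}} {T : Theory L} (hT : T.IsComplete)
    {M U : Str L} (hM : M.Models T) (hU : U.Models T) {κ : Cardinal.{u}}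
    (hsat : U.IsSaturated κ) (hκ : Cardinal.aleph0 ≤ κ) {X : Type} [Finite X] {x : X → L.Sorts}
    {I : Type u} [LinearOrder I] {c : I} (hI₁ : (Set.Iio c).Infinite)
    (hI₂ : (Set.Ioi c).Infinite) {a : I → Tuple M x} (ha : Indiscernible a)
    {P : Type} [Finite P] {p : P → L.Sorts} {e : Tuple M p}
    (hae : IndiscernibleOver a {i | i ≠ c} e) {n : ℕ} {i j : Fin n → I} (hi : StrictMono i)
    (hj : StrictMono j) (hjc : ∀ k, j k ≠ c)
    {φ : Formula L (Sum.elim (fun q : Fin n × X => x q.2) p)}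
    (hφ : ¬ (φ.Holds M (Tuple.join (fun q => a (i q.1) q.2) e) ↔
      φ.Holds M (Tuple.join (fun q => a (j q.1) q.2) e)))
    (Q : Type u) [LinearOrder Q] [Countable Q] {z w : Q} (hwz : w ≠ z) :
    ∃ (b : Q → Tuple U (fun q : Fin n × X => x q.2)) (e' : Tuple U p), Indiscernible b ∧
      IndiscernibleOver b {q | q ≠ z} e' ∧
      ¬ (φ.Holds U ((b z).join e') ↔ φ.Holds U ((b w).join e')) := by
  obtain ⟨mid, hmid⟩ := exists_stretch hI₁ hI₂ hi z
  let Good : Set Q → (Q → Fin n → I) → Prop := fun S R => R z = i ∧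
      (∀ q ∈ S, ∀ q' ∈ S, ∀ m m', R q m < R q' m' ↔
        (mid m ∧ mid m' ∧ (q < q' ∨ q = q' ∧ m < m')) ∨ (¬ (mid m ∧ mid m') ∧ m < m')) ∧
      ∀ q ∈ S, q ≠ z → ∀ m, R q m ≠ c
  let y : Fin n × X → L.Sorts := fun q => x q.2
  let v : (Q × (Fin n × X)) ⊕ P → L.Sorts := Sum.elim (fun q => y q.2) p
  let B : (Q → Fin n → I) → Tuple M v := fun R =>
    Tuple.join (x := fun q : Q × (Fin n × X) => y q.2) (fun q => a (R q.1 q.2.1) q.2.2) e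
  -- A formula enters `Φ` once it holds for all arrangements that are good on some finite `S`. For
  -- finitely many formulas, an arrangement good on the union of their sets `S` serves them all.
  let Φ : Set (Formula L v) := {χ | ∃ S : Set Q, S.Finite ∧ ∀ R, Good S R → χ.Holds M (B R)}
  have hΦ : ∀ Φ₀ ⊆ Φ, Φ₀.Finite → ∃ b : Tuple U v, ∀ χ ∈ Φ₀, χ.Holds U b := by
    intro Φ₀ hΦ₀ hfin
    have hΦ₀' : ∀ χ ∈ Φ₀, χ ∈ Φ := fun χ hχ => hΦ₀ hχ
    choose! S hS hSR using hΦ₀'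
    obtain ⟨R, hR⟩ := hmid (⋃ χ ∈ Φ₀, S χ) (hfin.biUnion fun χ hχ => hS χ hχ)
    obtain ⟨ξ, hξ⟩ := Formula.exists_conj hfin
    obtain ⟨b, hb⟩ := hT.exists_holds hM hU (φ := ξ) ⟨B R, (hξ M _).2 fun χ hχ =>
      hSR χ hχ R ⟨hR.1, fun q hq q' hq' => hR.2.1 q (Set.mem_biUnion hχ hq) q'
        (Set.mem_biUnion hχ hq'), fun q hq => hR.2.2 q (Set.mem_biUnion hχ hq)⟩⟩
    exact ⟨b, (hξ U b).1 hb⟩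
  obtain ⟨b, hb⟩ := hsat.exists_realization hκ Φ hΦ
  -- The parameters are left open as terms `τ` so that one argument covers both indiscernibility
  -- over the empty family and indiscernibility over `e'` off `z`.
  have hind : ∀ {P' : Type} {p' : P' → L.Sorts} (τ : ∀ k, Term L p (p' k)) (J : Set Q)
      (JI : Set I), IndiscernibleOver a JI (fun k => (τ k).eval M e) →
      (∀ S R, Good S R → ∀ q ∈ S, q ∈ J → ∀ m, R q m ∈ JI) →
      IndiscernibleOver (x := y) (fun (q : Q) (k : Fin n × X) => b (Sum.inl (q, k))) J
        (fun k => (τ k).eval U (fun k => b (Sum.inr k))) := by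
    intro P' p' τ J JI hJI hJ l ψ s s' hs hs' hsJ hsJ'
    let θ : (Fin l → Q) → ∀ k, Term L v (Sum.elim (fun k : Fin l × (Fin n × X) => y k.2) p' k) :=
      fun s => fun
      | Sum.inl k => (Term.var (Sum.inl (s k.1, k.2)) : Term L v (y k.2))
      | Sum.inr k => (τ k).subst (fun k => (Term.var (Sum.inr k) : Term L v (p k)))
    have hθ : ∀ (N : Str L) (d : Tuple N v) (s : Fin l → Q), (ψ.subst (θ s)).Holds N d ↔
        ψ.Holds N (Tuple.join (x := fun k : Fin l × (Fin n × X) => y k.2)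
          (fun k => d (Sum.inl (s k.1, k.2)))
          (fun k => (τ k).eval N (fun k => d (Sum.inr k)))) := by
      intro N d s
      rw [Formula.holds_subst]
      have : (fun k => (θ s k).eval N d) = Tuple.join (x := fun k : Fin l × (Fin n × X) => y k.2)
          (fun k => d (Sum.inl (s k.1, k.2)))
          (fun k => (τ k).eval N (fun k => d (Sum.inr k))) := by
        funext k
        rcases k with k | k
        · rfl
        · exact Term.eval_subst N _ _ _
      rw [this]
    obtain ⟨χ, hχ⟩ := Formula.exists_iff (ψ.subst (θ s)) (ψ.subst (θ s'))
    have hmem : χ ∈ Φ := by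
      refine ⟨Set.range s ∪ Set.range s', (Set.finite_range _).union (Set.finite_range _), ?_⟩
      intro R hR
      rw [hχ, hθ, hθ]
      -- Flattened to single indices, the two families of blocks have the same order pattern, since
      -- their labels do.
      have hψ' := hJI.holds_iff (K := Fin l × Fin n) (fun k => R (s k.1) k.2)
        (fun k => R (s' k.1) k.2)
        (fun k => hJ _ R hR _ (Or.inl ⟨_, rfl⟩) (hsJ _) _)
        (fun k => hJ _ R hR _ (Or.inr ⟨_, rfl⟩) (hsJ' _) _)
        (fun k k' => by
          rw [hR.2.1 _ (Or.inl ⟨_, rfl⟩) _ (Or.inl ⟨_, rfl⟩),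
            hR.2.1 _ (Or.inr ⟨_, rfl⟩) _ (Or.inr ⟨_, rfl⟩), hs.lt_iff_lt, hs'.lt_iff_lt,
            hs.injective.eq_iff, hs'.injective.eq_iff])
        (ψ.subst (fun
          | Sum.inl k => (Term.var (Sum.inl ((k.1, k.2.1), k.2.2)) : Term L
              (Sum.elim (fun q : (Fin l × Fin n) × X => x q.2) p') (x k.2.2))
          | Sum.inr k => (Term.var (Sum.inr k) : Term L
              (Sum.elim (fun q : (Fin l × Fin n) × X => x q.2) p') (p' k))))
      have h₁ : ∀ d d' : Tuple M (Sum.elim (fun k : Fin l × (Fin n × X) => y k.2) p'), d = d' →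
          (ψ.Holds M d ↔ ψ.Holds M d') := by rintro d _ rfl; rfl
      refine Iff.trans (h₁ _ _ ?_) (((Formula.holds_subst M _ ψ _).symm.trans hψ').trans
        ((Formula.holds_subst M _ ψ _).trans (h₁ _ _ ?_)))
      all_goals funext k; cases k <;> rfl
    have := hb χ hmem
    rw [hχ, hθ, hθ] at this
    exact this
  refine ⟨fun q k => b (Sum.inl (q, k)), fun k => b (Sum.inr k), ?_, ?_, ?_⟩
  · have := hind (p' := (Empty.elim : Empty → L.Sorts)) (fun k => k.elim) Set.univ Set.univ ?_
      (fun _ _ _ _ _ _ _ => trivial)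
    · unfold Indiscernible
      convert this using 1
    · unfold Indiscernible at ha
      convert ha using 1
  · exact hind (fun k => Term.var k) {q | q ≠ z} {i | i ≠ c} hae
      (fun S R hR q hq hqz => hR.2.2 q hq hqz)
  · obtain ⟨ξ, hξ⟩ : ∃ ξ : Formula L v, ∀ (N : Str L) (d : Tuple N v), ξ.Holds N d ↔
        (φ.Holds N (Tuple.join (x := y) (fun k => d (Sum.inl (z, k))) (fun k => d (Sum.inr k))) ↔
        φ.Holds N (Tuple.join (x := y) (fun k => d (Sum.inl (w, k)))
          (fun k => d (Sum.inr k)))) := by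
      let θ : Q → ∀ k, Term L v (Sum.elim y p k) := fun q => fun
        | Sum.inl k => (Term.var (Sum.inl (q, k)) : Term L v (y k))
        | Sum.inr k => (Term.var (Sum.inr k) : Term L v (p k))
      obtain ⟨ξ, hξ⟩ := Formula.exists_iff (φ.subst (θ z)) (φ.subst (θ w))
      refine ⟨ξ, fun N d => (hξ N d).trans ?_⟩
      have hθ : ∀ q, (fun k => (θ q k).eval N d) = Tuple.join (x := y)
          (fun k => d (Sum.inl (q, k))) (fun k => d (Sum.inr k)) := fun q => by
        funext k; cases k <;> rfl
      rw [Formula.holds_subst, Formula.holds_subst, hθ, hθ]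
      exact Iff.rfl
    obtain ⟨χ, hχ⟩ := Formula.exists_not ξ
    have hmem : χ ∈ Φ := by
      refine ⟨{w}, Set.finite_singleton w, fun R hR => ?_⟩
      rw [hχ, hξ]
      intro h
      apply hφ
      -- The block at `w` is increasing and avoids `c`, so `φ` has the same truth value on it as on
      -- `j`; the block at `z` is `i` itself.
      have hRw : StrictMono (R w) := fun m m' hm => by
        rw [hR.2.1 w rfl w rfl]
        simp only [hm, lt_irrefl, false_or, and_true]
        tauto
      have h₂ := hae n φ (R w) j hRw hj (fun m => hR.2.2 w rfl hwz m) hjc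
      rw [← hR.1]
      exact Iff.trans h h₂
    have := hb χ hmem
    rw [hχ, hξ] at this
    exact this


/-! ### Terms and generated substructures -/

section Span

variable {L : Language.{u}}

theorem Formula.exists_equal {X : Type v} {x : X → L.Sorts} {s : L.Sorts} (t₁ t₂ : Term L x s) :
    ∃ χ : Formula L x, ∀ (M : Str L) (a : Tuple M x),
      χ.Holds M a ↔ t₁.eval M a = t₂.eval M a := by
  let θ : ∀ i, Term L (Sum.elim x (Fin.elim0 : Fin 0 → L.Sorts)) (x i) := fun i =>
    (Term.var (Sum.inl i) : Term L (Sum.elim x (Fin.elim0 : Fin 0 → L.Sorts)) (x i))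
  refine ⟨.equal (t₁.subst θ) (t₂.subst θ), fun M a => ?_⟩
  simp only [Formula.Holds, BFormula.Realize, Term.eval_subst]
  exact Iff.rfl

theorem InSpan.mono {M : Str L} {A B : SSet M} (h : A ≤ B) {s : L.Sorts} {m : M s}
    (hm : InSpan A s m) : InSpan B s m := by
  induction hm with
  | base hm => exact .base (h _ hm)
  | app f a _ ih => exact .app f a ih

theorem Term.eval_mem_span {M : Str L} {X : Type v} {x : X → L.Sorts} {a : Tuple M x}
    {A : SSet M} (ha : ∀ k, a k ∈ A (x k)) {s : L.Sorts} (t : Term L x s) :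
    InSpan A s (t.eval M a) := by
  induction t with
  | var k => exact .base (ha k)
  | app f ts ih => exact .app f _ ih

theorem InSpan.exists_term {M : Str L} {B : SSet M} {Y : Type v} {y : Y → L.Sorts} {d : Tuple M y}
    {s : L.Sorts} {m : M s} (hm : InSpan (B ⊔ d.coords) s m) :
    ∃ (W : Type) (_ : Finite W) (z : W → L.Sorts) (w : Tuple M z) (h : Term L (Sum.elim z y) s),
      (∀ k, w k ∈ B (z k)) ∧ m = h.eval M (w.join d) := by
  induction hm with
  | @base s m hm =>
    rcases hm with hm | hm
    · exact ⟨Unit, inferInstance, fun _ => s, fun _ => m,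
        (Term.var (Sum.inl ()) : Term L (Sum.elim (fun _ : Unit => s) y) s), fun _ => hm, rfl⟩
    · cases hm with
      | coord k =>
        exact ⟨Empty, inferInstance, Empty.elim, fun k => k.elim,
          (Term.var (Sum.inr k) : Term L (Sum.elim Empty.elim y) (y k)), fun k => k.elim, rfl⟩
  | app f a _ ih =>
    choose W hW z w h hw hm using ih
    refine ⟨Σ i, W i, inferInstance, fun k => z k.1 k.2, fun k => w k.1 k.2,
      .app f fun i => (h i).subst (fun
        | Sum.inl k => (Term.var (Sum.inl (Sigma.mk i k)) :
            Term L (Sum.elim (fun k : Σ i, W i => z k.1 k.2) y) (z i k))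
        | Sum.inr k => (Term.var (Sum.inr k) :
            Term L (Sum.elim (fun k : Σ i, W i => z k.1 k.2) y) (y k))),
      fun k => hw k.1 k.2, ?_⟩
    simp only [Term.eval]
    congr 1
    funext i
    rw [hm, Term.eval_subst]
    congr 1
    funext k
    cases k <;> rfl

/-- The set of coordinates of the members `a i`, `i ∈ B`, of a sequence. -/
def seqCoords {M : Str L} {I : Type u} {X : Type} {x : X → L.Sorts} (a : I → Tuple M x)
    (B : Set I) : SSet M := fun s => {m | ∃ i ∈ B, InCoords (a i) s m}

/-- The tuple of the coordinates of finitely many members of a sequence, and parameters. -/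
abbrev seqTuple {M : Str L} {I : Type u} {X : Type} {x : X → L.Sorts} (a : I → Tuple M x)
    {K : Type w} (r : K → I) {P : Type v} {p : P → L.Sorts} (e : Tuple M p) :
    Tuple M (Sum.elim (fun q : K × X => x q.2) p) :=
  Tuple.join (x := fun q : K × X => x q.2) (fun q => a (r q.1) q.2) e

theorem Term.exists_reindex {X : Type} {x : X → L.Sorts} {P : Type v} {p : P → L.Sorts}
    {K K' : Type w} (f : K → K') {s : L.Sorts}
    (t : Term L (Sum.elim (fun q : K × X => x q.2) p) s) :
    ∃ t' : Term L (Sum.elim (fun q : K' × X => x q.2) p) s, ∀ (M : Str L) (I : Type u)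
      (a : I → Tuple M x) (r : K' → I) (e : Tuple M p),
      t'.eval M (seqTuple a r e) = t.eval M (seqTuple a (fun k => r (f k)) e) := by
  refine ⟨t.subst (fun
    | Sum.inl q => (Term.var (Sum.inl (f q.1, q.2)) :
        Term L (Sum.elim (fun q : K' × X => x q.2) p) (x q.2))
    | Sum.inr k => (Term.var (Sum.inr k) :
        Term L (Sum.elim (fun q : K' × X => x q.2) p) (p k))), fun M I a r e => ?_⟩
  rw [Term.eval_subst]
  congr 1
  funext k
  cases k <;> rfl

theorem InSpan.exists_term_seq {M : Str L} {I : Type u} {X : Type} {x : X → L.Sorts}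
    {a : I → Tuple M x} {B : Set I} {P : Type v} {p : P → L.Sorts} {e : Tuple M p}
    {s : L.Sorts} {m : M s} (hm : InSpan (seqCoords a B ⊔ e.coords) s m) :
    ∃ (S : Finset I) (τ : Term L (Sum.elim (fun q : S × X => x q.2) p) s),
      (∀ i ∈ S, i ∈ B) ∧ m = τ.eval M (seqTuple a Subtype.val e) := by
  classical
  induction hm with
  | @base s m hm =>
    rcases hm with ⟨i, hi, hm⟩ | hm
    · cases hm with
      | coord k =>
        exact ⟨{i}, (Term.var (Sum.inl (Subtype.mk i (Finset.mem_singleton_self i), k)) :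
          Term L (Sum.elim (fun q : ({i} : Finset I) × X => x q.2) p) (x k)), by simpa using hi, rfl⟩
    · cases hm with
      | coord k =>
        exact ⟨∅, (Term.var (Sum.inr k) :
          Term L (Sum.elim (fun q : (∅ : Finset I) × X => x q.2) p) (p k)), by simp, rfl⟩
  | app f b _ ih =>
    choose S τ hS hm using ih
    obtain ⟨S', hS'⟩ : ∃ S' : Finset I, ∀ i, i ∈ S' ↔ ∃ k, i ∈ S k :=
      ⟨Finset.univ.biUnion S, by simp⟩
    have : ∀ i, ∃ t : Term L (Sum.elim (fun q : S' × X => x q.2) p) _,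
        b i = t.eval M (seqTuple a Subtype.val e) := by
      intro i
      let f' : S i → S' := fun k => ⟨k.1, (hS' _).2 ⟨i, k.2⟩⟩
      obtain ⟨t, ht⟩ := (τ i).exists_reindex f'
      exact ⟨t, (hm i).trans (ht M I a Subtype.val e).symm⟩
    choose t ht using this
    refine ⟨S', .app f t, ?_, ?_⟩
    · intro i hi
      obtain ⟨k, hk⟩ := (hS' i).1 hi
      exact hS k i hk
    · simp only [Term.eval]
      congr 1
      exact funext ht

/-! ### Sequences of terms in an indiscernible sequence -/

/-- Finitely many members `a (J k)` may be used as constants as long as all running indices lie in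
the same cut over `J`: the order pattern of running and constant indices together is then determined
by the running ones. -/
theorem IndiscernibleOver.of_terms_seq {M : Str L} {X : Type} {x : X → L.Sorts} {I : Type u}
    [LinearOrder I] {a : I → Tuple M x} {S : Set I} {P : Type v} {p : P → L.Sorts} {e : Tuple M p}
    (ha : IndiscernibleOver a S e) {K : Type u} [Finite K] {J : K → I} (hJ : ∀ k, J k ∈ S)
    {I' : Type u} [LinearOrder I'] {ι : I' → I} (hι : StrictMono ι) {S' : Set I'}
    (hS' : ∀ i ∈ S', ι i ∈ S)
    (hcut : ∀ k i j, (J k < ι i ↔ J k < ι j) ∧ (ι i < J k ↔ ι j < J k))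
    {X' : Type} {x' : X' → L.Sorts} {a' : I' → Tuple M x'}
    (ha' : ∀ k, ∃ α : Term L (Sum.elim (fun q : K × X => x q.2) x) (x' k),
      ∀ i, a' i k = α.eval M (seqTuple a J (a (ι i))))
    {P' : Type w} {p' : P' → L.Sorts} {e' : Tuple M p'}
    (he' : ∀ k, ∃ β : Term L (Sum.elim (fun q : K × X => x q.2) p) (p' k),
      e' k = β.eval M (seqTuple a J e)) :
    IndiscernibleOver a' S' e' := by
  choose α hα using ha'
  choose β hβ using he'
  intro n φ i j hi hj hiS hjS
  let y : ((Fin n ⊕ K) × X) ⊕ P → L.Sorts := Sum.elim (fun q => x q.2) p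
  let θ : ∀ k, Term L y (Sum.elim (fun k : Fin n × X' => x' k.2) p' k) := fun
    | Sum.inl k => (α k.2).subst (fun
      | Sum.inl q => (Term.var (Sum.inl (Sum.inr q.1, q.2)) : Term L y (x q.2))
      | Sum.inr l => (Term.var (Sum.inl (Sum.inl k.1, l)) : Term L y (x l)))
    | Sum.inr k => (β k).subst (fun
      | Sum.inl q => (Term.var (Sum.inl (Sum.inr q.1, q.2)) : Term L y (x q.2))
      | Sum.inr l => (Term.var (Sum.inr l) : Term L y (p l)))
  have hθ : ∀ i : Fin n → I', (fun k => (θ k).eval M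
      (seqTuple a (Sum.elim (fun m => ι (i m)) J) e)) =
      Tuple.join (x := fun k : Fin n × X' => x' k.2) (fun k => a' (i k.1) k.2) e' := by
    intro i
    funext k
    rcases k with k | k
    · refine (Term.eval_subst M _ _ _).trans (Eq.trans ?_ (hα k.2 (i k.1)).symm)
      congr 1
      funext l
      cases l <;> rfl
    · refine (Term.eval_subst M _ _ _).trans (Eq.trans ?_ (hβ k).symm)
      congr 1
      funext l
      cases l <;> rfl
  have := ha.holds_iff (Sum.elim (fun m => ι (i m)) J) (Sum.elim (fun m => ι (j m)) J)
    (by rintro (m | k); exacts [hS' _ (hiS m), hJ k])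
    (by rintro (m | k); exacts [hS' _ (hjS m), hJ k])
    (by
      rintro (m | k) (m' | k')
      · simp [hι.lt_iff_lt, hi.lt_iff_lt, hj.lt_iff_lt]
      · exact (hcut k' (i m) (j m)).2
      · exact (hcut k (i m') (j m')).1
      · rfl) (φ.subst θ)
  rw [Formula.holds_subst, Formula.holds_subst, hθ, hθ] at this
  exact this

end Span

/-! ### Distal configurations -/

/-- The elements with the same cut as `c` over a family. -/
abbrev SameCut {I : Type u} [LinearOrder I] {K : Type v} (J : K → I) (c : I) : Type u :=
  {i // ∀ k, (J k < i ↔ J k < c) ∧ (i < J k ↔ c < J k)}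

/-- The element `c` itself. -/
abbrev SameCut.center {I : Type u} [LinearOrder I] {K : Type v} (J : K → I) (c : I) :
    SameCut J c := ⟨c, fun _ => ⟨Iff.rfl, Iff.rfl⟩⟩

/-- Since `J` is finite, avoids `c`, and neither side has an extremal element at `c`, the cut
contains points on both sides, and again none closest to `c`. A nonempty side without such an
extremal point is infinite. -/
theorem DistalConfiguration.sameCut {I : Type u} [LinearOrder I] {c : I}
    (hc : DistalConfiguration c) {K : Type v} [Finite K] {J : K → I} (hJ : ∀ k, J k ≠ c) :
    DistalConfiguration (SameCut.center J c) := by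
  obtain ⟨h₁, h₂, h₃, h₄⟩ := hc
  have h₅ : ∀ i < c, ∃ j < c, i < j := by
    intro i hi
    by_contra! h
    exact h₃ ⟨i, hi, h⟩
  have h₆ : ∀ i, c < i → ∃ j, c < j ∧ j < i := by
    intro i hi
    by_contra! h
    exact h₄ ⟨i, hi, h⟩
  -- A point on the left that is closer to `c` than every `J k` there; the inserted `i₀` covers the
  -- case that there are none.
  have h₇ : ∃ i < c, ∀ k, J k < c → J k < i := by
    obtain ⟨i₀, hi₀⟩ := h₁.nonempty
    obtain ⟨m, ⟨hm, hmc⟩, hmax⟩ := Set.exists_max_image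
      ((insert i₀ (Set.range J)) ∩ Set.Iio c) id
      (((Set.finite_range J).insert i₀).inter_of_left _) ⟨i₀, Set.mem_insert _ _, hi₀⟩
    obtain ⟨i, hi, hmi⟩ := h₅ m hmc
    exact ⟨i, hi, fun k hk => (hmax _ ⟨Set.mem_insert_of_mem _ ⟨k, rfl⟩, hk⟩).trans_lt hmi⟩
  have h₈ : ∃ i, c < i ∧ ∀ k, c < J k → i < J k := by
    obtain ⟨i₀, hi₀⟩ := h₂.nonempty
    obtain ⟨m, ⟨hm, hmc⟩, hmin⟩ := Set.exists_min_image
      ((insert i₀ (Set.range J)) ∩ Set.Ioi c) id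
      (((Set.finite_range J).insert i₀).inter_of_left _) ⟨i₀, Set.mem_insert _ _, hi₀⟩
    obtain ⟨i, hi, hmi⟩ := h₆ m hmc
    exact ⟨i, hi, fun k hk => hmi.trans_le (hmin _ ⟨Set.mem_insert_of_mem _ ⟨k, rfl⟩, hk⟩)⟩
  have hcut : ∀ i, (∀ k, J k < c → J k < i) → (∀ k, c < J k → i < J k) →
      ∀ k, (J k < i ↔ J k < c) ∧ (i < J k ↔ c < J k) := by
    intro i hl hr k
    rcases lt_or_gt_of_ne (hJ k) with hk | hk
    · exact ⟨iff_of_true (hl k hk) hk, iff_of_false (hl k hk).not_gt hk.not_gt⟩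
    · exact ⟨iff_of_false (hr k hk).not_gt hk.not_gt, iff_of_true (hr k hk) hk⟩
  have hlow : ¬ ∃ i, IsGreatest (Set.Iio (SameCut.center J c)) i := by
    rintro ⟨⟨i, hi⟩, hic, hmax⟩
    obtain ⟨j, hj, hij⟩ := h₅ i hic
    exact (hmax (a := ⟨j, hcut j (fun k hk => ((hi k).1.2 hk).trans hij)
      (fun k hk => hj.trans hk)⟩) hj).not_gt hij
  have hhigh : ¬ ∃ i, IsLeast (Set.Ioi (SameCut.center J c)) i := by
    rintro ⟨⟨i, hi⟩, hic, hmin⟩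
    obtain ⟨j, hj, hij⟩ := h₆ i hic
    exact (hmin (a := ⟨j, hcut j (fun k hk => hk.trans hj)
      (fun k hk => hij.trans ((hi k).2.2 hk))⟩) hj).not_gt hij
  refine ⟨fun hfin => ?_, fun hfin => ?_, hlow, hhigh⟩
  · obtain ⟨i, hi, hJi⟩ := h₇
    obtain ⟨m, hm, hmax⟩ := Set.exists_max_image _ id hfin
      ⟨⟨i, hcut i hJi (fun k hk => hi.trans hk)⟩, hi⟩
    exact hlow ⟨m, hm, hmax⟩
  · obtain ⟨i, hi, hJi⟩ := h₈
    obtain ⟨m, hm, hmin⟩ := Set.exists_min_image _ id hfin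
      ⟨⟨i, hcut i (fun k hk => hk.trans hi) hJi⟩, hi⟩
    exact hhigh ⟨m, hm, hmin⟩


/-! ### The base language inside the expansion -/

section Expansion

variable {L : Language.{u}} {F : L.Sorts → L.Sorts → Type u}

/-- An `L`-term as an `L(F)`-term. -/
def Term.lift (F : L.Sorts → L.Sorts → Type u) {X : Type v} {x : X → L.Sorts} :
    ∀ {s : L.Sorts}, Term L x s → Term (L.expand F) (x : X → (L.expand F).Sorts) s
  | _, .var i => Term.var (L := L.expand F) i
  | _, .app f ts => Term.app (L := L.expand F) (ExpFunc.old f) (fun i => (ts i).lift F)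

theorem Term.eval_lift (U : Str (L.expand F)) {X : Type v} {x : X → L.Sorts} (a : Tuple U.base x)
    {s : L.Sorts} (t : Term L x s) :
    (t.lift F).eval U a = t.eval U.base a := by
  induction t with
  | var i => rfl
  | app f ts ih =>
    simp only [Term.lift, Term.eval]
    rw [funext ih]
    rfl

/-- An `L`-formula as an `L(F)`-formula. -/
def BFormula.lift (F : L.Sorts → L.Sorts → Type u) {X : Type v} {x : X → L.Sorts} :
    ∀ {n : ℕ} {σ : Fin n → L.Sorts}, BFormula L x n σ →
      BFormula (L.expand F) (x : X → (L.expand F).Sorts) n σ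
  | _, _, .falsum => .falsum
  | _, σ, .equal t₁ t₂ =>
      BFormula.equal (L := L.expand F) (x := x) (σ := σ) (t₁.lift F) (t₂.lift F)
  | _, σ, .rel R ts => BFormula.rel (L := L.expand F) (x := x) (σ := σ) R (fun i => (ts i).lift F)
  | _, _, .imp φ ψ => .imp (φ.lift F) (ψ.lift F)
  | _, _, .all s φ => BFormula.all (L := L.expand F) s (φ.lift F)

theorem BFormula.realize_lift (U : Str (L.expand F)) {X : Type v} {x : X → L.Sorts}
    (a : Tuple U.base x) {n : ℕ} {σ : Fin n → L.Sorts} (φ : BFormula L x n σ) :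
    ∀ b : Tuple U.base σ, (φ.lift F).Realize U a b ↔ φ.Realize U.base a b := by
  induction φ with
  | falsum => exact fun b => Iff.rfl
  | @equal n σ s t₁ t₂ =>
    intro b
    have h₁ := Term.eval_lift U (a.join b) t₁
    have h₂ := Term.eval_lift U (a.join b) t₂
    exact iff_of_eq (congrArg₂ Eq h₁ h₂)
  | rel R ts =>
    intro b
    have h := funext fun i => Term.eval_lift U (a.join b) (ts i)
    exact iff_of_eq (congrArg (U.rel (L := L.expand F) R) h)
  | imp φ ψ ih₁ ih₂ => exact fun b => imp_congr (ih₁ b) (ih₂ b)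
  | all s φ ih => exact fun b => forall_congr' fun m => ih (Tuple.cons m b)

def Formula.lift (F : L.Sorts → L.Sorts → Type u) {X : Type v} {x : X → L.Sorts}
    (φ : Formula L x) : Formula (L.expand F) (x : X → (L.expand F).Sorts) :=
  BFormula.lift F φ

theorem Formula.holds_lift (U : Str (L.expand F)) {X : Type v} {x : X → L.Sorts}
    (φ : Formula L x) (a : Tuple U.base x) :
    (φ.lift F).Holds U a ↔ φ.Holds U.base a :=
  BFormula.realize_lift U a φ _

theorem Language.card_le_card_expand : L.card ≤ (L.expand F).card := by
  refine max_le_max le_rfl (Cardinal.mk_le_of_injective (f := Sum.map id (Sum.map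
    (fun f => (⟨f.1, f.2.1, f.2.2.1, ExpFunc.old f.2.2.2⟩ :
      Σ (n : ℕ) (σ : Fin n → L.Sorts) (s : L.Sorts), ExpFunc L F n σ s)) id)) ?_)
  refine Function.Injective.sumMap Function.injective_id
    (Function.Injective.sumMap ?_ Function.injective_id)
  rintro ⟨n, σ, s, f⟩ ⟨n', σ', s', f'⟩ h
  cases h
  rfl

/-- A sublanguage of `L` as a sublanguage of `L(F)`. -/
def Inclusion.toExpand (F : L.Sorts → L.Sorts → Type u) {L' : Language.{u}} (ι : Inclusion L' L) :
    Inclusion L' (L.expand F) where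
  srt := ι.srt
  func f := ExpFunc.old (ι.func f)
  rel := ι.rel
  srt_injective := ι.srt_injective
  func_injective := fun h => ι.func_injective (ExpFunc.old.inj h)
  rel_injective := fun h => ι.rel_injective h

/-- The same `κ` works: `L` is no larger than `L(F)`, its formulas are `L(F)`-formulas, and each
reduct of the `L`-reduct is a reduct of `U`. -/
theorem Str.IsMonster.base {T : Theory L} {TF : Theory (L.expand F)} {U : Str (L.expand F)}
    (hU : U.IsMonster TF) (hT : U.base.Models T) : U.base.IsMonster T := by
  obtain ⟨-, κ, hκ, hsat, hhom⟩ := hU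
  refine ⟨hT, κ, Language.card_le_card_expand.trans_lt hκ, ?_, fun L' ι => hhom L' (ι.toExpand F)⟩
  intro A hA X _ x Φ hΦ
  obtain ⟨a, ha⟩ := hsat A hA X x (Formula.lift F '' Φ) (by
    intro Φ₀ hΦ₀ hfin
    have : Nonempty (Formula L (Sum.elim x A.elemSort)) := ⟨(Formula.exists_true _).choose⟩
    have hΦ₀' : ∀ φ ∈ Φ₀, φ ∈ Formula.lift F '' Φ := fun φ hφ => hΦ₀ hφ
    choose! f hf using hΦ₀'
    obtain ⟨a, ha⟩ := hΦ (f '' Φ₀) (by rintro _ ⟨φ, hφ, rfl⟩; exact (hf φ hφ).1) (hfin.image f)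
    refine ⟨a, fun φ hφ => ?_⟩
    rw [← (hf φ hφ).2]
    exact (Formula.holds_lift U _ _).2 (ha _ ⟨φ, hφ, rfl⟩))
  exact ⟨a, fun φ hφ => (Formula.holds_lift U _ _).1 (ha _ ⟨φ, hφ, rfl⟩)⟩

theorem IndiscernibleOver.base {U : Str (L.expand F)} {X : Type} {x : X → L.Sorts} {I : Type u}
    [LinearOrder I] {a : I → Tuple U.base x} {J : Set I} {P : Type v} {p : P → L.Sorts}
    {e : Tuple U.base p}
    (h : IndiscernibleOver (L := L.expand F) (M := U) (x := x) a J (p := p) e) :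
    IndiscernibleOver (M := U.base) a J e := by
  intro n φ i j hi hj hiJ hjJ
  have := h n (φ.lift F) i j hi hj hiJ hjJ
  exact ((Formula.holds_lift U φ _).symm.trans this).trans (Formula.holds_lift U φ _)

/-! ### Sequences in distal configuration -/

/-- An indiscernible sequence in distal configuration at `c`, indiscernible over the finite tuple
`e` off `c`. -/
structure Config (U : Str (L.expand F)) where
  I : Type u
  [ord : LinearOrder I]
  c : I
  dist : DistalConfiguration c
  X : Type
  [finX : Finite X]
  x : X → L.Sorts
  a : I → Tuple U.base x
  P : Type
  [finP : Finite P]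
  p : P → L.Sorts
  e : Tuple U.base p
  ind : Indiscernible (L := L.expand F) (M := U) (x := x) a
  indOff : IndiscernibleOver (L := L.expand F) (M := U) (x := x) a {i | i ≠ c} (p := p) e

attribute [instance] Config.ord Config.finX Config.finP

namespace Config

variable {U : Str (L.expand F)}

/-- The value is given by a single `L`-term in the sequence and the parameters. -/
def TermDef (C : Config U) {s : L.Sorts} (u : C.I → U.base s) : Prop :=
  ∃ τ : Term L (Sum.elim C.x C.p) s, ∀ i, u i = τ.eval U.base ((C.a i).join C.e)

/-- The relation is given by a single `L`-formula in the sequence and the parameters. -/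
def FormDef (C : Config U) (S : C.I → Prop) : Prop :=
  ∃ φ : Formula L (Sum.elim C.x C.p), ∀ i, S i ↔ φ.Holds U.base ((C.a i).join C.e)

/-- The configuration `C'` arises from `C` by restricting the index set and adding coordinates. -/
structure Refinement (C' C : Config U) where
  map : C'.I → C.I
  map_center : map C'.c = C.c
  map_ne : ∀ i, i ≠ C'.c → map i ≠ C.c
  seq_def : ∀ k, C'.TermDef fun i => C.a (map i) k
  param_def : ∀ k, C'.TermDef fun _ => C.e k

theorem Refinement.exists_subst {C' C : Config U} (r : C'.Refinement C) :
    ∃ θ : ∀ k, Term L (Sum.elim C'.x C'.p) (Sum.elim C.x C.p k), ∀ i,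
      (fun k => (θ k).eval U.base ((C'.a i).join C'.e)) = (C.a (r.map i)).join C.e := by
  have : ∀ k, ∃ t : Term L (Sum.elim C'.x C'.p) (Sum.elim C.x C.p k), ∀ i,
      t.eval U.base ((C'.a i).join C'.e) = ((C.a (r.map i)).join C.e) k := by
    rintro (k | k)
    · obtain ⟨t, ht⟩ := r.seq_def k
      exact ⟨t, fun i => (ht i).symm⟩
    · obtain ⟨t, ht⟩ := r.param_def k
      exact ⟨t, fun i => (ht i).symm⟩
  choose θ hθ using this
  exact ⟨θ, fun i => funext fun k => hθ k i⟩

theorem TermDef.comp {C' C : Config U} {s : L.Sorts} {u : C.I → U.base s} (h : C.TermDef u)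
    (r : C'.Refinement C) : C'.TermDef fun i => u (r.map i) := by
  obtain ⟨τ, hτ⟩ := h
  obtain ⟨θ, hθ⟩ := r.exists_subst
  refine ⟨τ.subst θ, fun i => ?_⟩
  rw [Term.eval_subst, hθ]
  exact hτ _

theorem FormDef.comp {C' C : Config U} {S : C.I → Prop} (h : C.FormDef S)
    (r : C'.Refinement C) : C'.FormDef fun i => S (r.map i) := by
  obtain ⟨φ, hφ⟩ := h
  obtain ⟨θ, hθ⟩ := r.exists_subst
  refine ⟨φ.subst θ, fun i => ?_⟩
  rw [Formula.holds_subst, hθ]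
  exact hφ _

/-- The trivial refinement. -/
def Refinement.refl (C : Config U) : C.Refinement C where
  map := id
  map_center := rfl
  map_ne _ h := h
  seq_def k := ⟨(Term.var (Sum.inl k) : Term L (Sum.elim C.x C.p) (C.x k)), fun _ => rfl⟩
  param_def k := ⟨(Term.var (Sum.inr k) : Term L (Sum.elim C.x C.p) (C.p k)), fun _ => rfl⟩

/-- Composition of refinements. -/
def Refinement.trans {C'' C' C : Config U} (r' : C''.Refinement C') (r : C'.Refinement C) :
    C''.Refinement C where
  map i := r.map (r'.map i)
  map_center := by rw [r'.map_center, r.map_center]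
  map_ne i h := r.map_ne _ (r'.map_ne i h)
  seq_def k := (r.seq_def k).comp r'
  param_def k := (r.param_def k).comp r'

/-- The value becomes `TermDef` in a refinement of any refinement. -/
def TermDefRefined (C : Config U) {s : L.Sorts} (u : C.I → U.base s) : Prop :=
  ∀ (C' : Config U) (r : C'.Refinement C), ∃ (C'' : Config U) (r' : C''.Refinement C'),
    C''.TermDef fun i => u (r.map (r'.map i))

/-- The relation becomes `FormDef` in a refinement of any refinement. -/
def FormDefRefined (C : Config U) (S : C.I → Prop) : Prop :=
  ∀ (C' : Config U) (r : C'.Refinement C), ∃ (C'' : Config U) (r' : C''.Refinement C'),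
    C''.FormDef fun i => S (r.map (r'.map i))

theorem TermDef.refined {C : Config U} {s : L.Sorts} {u : C.I → U.base s} (h : C.TermDef u) :
    C.TermDefRefined u :=
  fun C' r => ⟨C', Refinement.refl C', h.comp r⟩

/-- Values are treated one after another. Each can be treated inside the refinement made for the
previous ones, because `TermDefRefined` quantifies over all refinements, and earlier terms survive
by `TermDef.comp`. -/
theorem exists_refinement_termDef {C : Config U} {n : ℕ} {σ : Fin n → L.Sorts}
    {u : ∀ k, C.I → U.base (σ k)} (h : ∀ k, C.TermDefRefined (u k)) (C' : Config U)
    (r : C'.Refinement C) : ∃ (C'' : Config U) (r' : C''.Refinement C'),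
      ∀ k, C''.TermDef fun i => u k (r.map (r'.map i)) := by
  classical
  suffices H : ∀ S : Finset (Fin n), ∃ (C'' : Config U) (r' : C''.Refinement C'),
      ∀ k ∈ S, C''.TermDef fun i => u k (r.map (r'.map i)) by
    obtain ⟨C'', r', h⟩ := H Finset.univ
    exact ⟨C'', r', fun k => h k (Finset.mem_univ k)⟩
  intro S
  induction S using Finset.induction_on with
  | empty => exact ⟨C', Refinement.refl C', by simp⟩
  | insert k S _ ih =>
    obtain ⟨C₁, r₁, h₁⟩ := ih
    obtain ⟨C₂, r₂, h₂⟩ := h k C₁ (r₁.trans r)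
    refine ⟨C₂, r₂.trans r₁, fun l hl => ?_⟩
    rcases Finset.mem_insert.1 hl with rfl | hl
    · exact h₂
    · exact (h₁ l hl).comp r₂

theorem TermDefRefined.app_old {C : Config U} {n : ℕ} {σ : Fin n → L.Sorts} {s : L.Sorts}
    (f : L.Func n σ s) {u : ∀ k, C.I → U.base (σ k)} (h : ∀ k, C.TermDefRefined (u k)) :
    C.TermDefRefined fun i => U.base.fn f fun k => u k i := by
  intro C' r
  obtain ⟨C'', r', h⟩ := exists_refinement_termDef h C' r
  choose τ hτ using h
  refine ⟨C'', r', .app f τ, fun i => ?_⟩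
  simp only [Term.eval]
  rw [funext fun k => hτ k i]

theorem FormDefRefined.equal {C : Config U} {s : L.Sorts} {u v : C.I → U.base s}
    (hu : C.TermDefRefined u) (hv : C.TermDefRefined v) : C.FormDefRefined fun i => u i = v i := by
  intro C' r
  obtain ⟨C₁, r₁, h₁⟩ := hu C' r
  obtain ⟨C₂, r₂, τ₂, h₂⟩ := hv C₁ (r₁.trans r)
  obtain ⟨τ₁, h₁⟩ := h₁.comp r₂
  obtain ⟨χ, hχ⟩ := Formula.exists_equal τ₁ τ₂
  refine ⟨C₂, r₂.trans r₁, χ, fun i => ?_⟩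
  rw [hχ, ← h₁, ← h₂]
  rfl

theorem FormDefRefined.rel {C : Config U} {n : ℕ} {σ : Fin n → L.Sorts}
    (R : L.Rel n σ) {u : ∀ k, C.I → U.base (σ k)} (h : ∀ k, C.TermDefRefined (u k)) :
    C.FormDefRefined fun i => U.base.rel R fun k => u k i := by
  intro C' r
  obtain ⟨C'', r', h⟩ := exists_refinement_termDef h C' r
  choose τ hτ using h
  refine ⟨C'', r', .rel R fun k => (τ k).subst fun l => (Term.var (Sum.inl l) :
    Term L (Sum.elim (Sum.elim C''.x C''.p) (Fin.elim0 : Fin 0 → L.Sorts)) _), fun i => ?_⟩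
  refine iff_of_eq (congrArg (U.base.rel R) (funext fun k => ?_))
  refine (hτ k i).trans (Eq.trans ?_ (Term.eval_subst U.base _ _ (τ k)).symm)
  rfl

theorem FormDefRefined.imp {C : Config U} {S S' : C.I → Prop} (hS : C.FormDefRefined S)
    (hS' : C.FormDefRefined S') : C.FormDefRefined fun i => S i → S' i := by
  intro C' r
  obtain ⟨C₁, r₁, h₁⟩ := hS C' r
  obtain ⟨C₂, r₂, φ₂, h₂⟩ := hS' C₁ (r₁.trans r)
  obtain ⟨φ₁, h₁⟩ := h₁.comp r₂
  exact ⟨C₂, r₂.trans r₁, .imp φ₁ φ₂, fun i => imp_congr (h₁ i) (h₂ i)⟩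

theorem termDefRefined_app {C : Config U}
    (hnew : ∀ {s t : L.Sorts} (f : F s t) {u : C.I → U.base s}, C.TermDefRefined u →
      C.TermDefRefined fun i => U.unary f (u i))
    {n : ℕ} {σ : Fin n → L.Sorts} {s : L.Sorts} (f : ExpFunc L F n σ s)
    {u : ∀ k, C.I → U.base (σ k)} (h : ∀ k, C.TermDefRefined (u k)) :
    C.TermDefRefined (s := s) fun i => U.fn (L := L.expand F) (σ := σ) f fun k => u k i := by
  cases f with
  | old f => exact TermDefRefined.app_old f h
  | new f =>
    refine cast (congrArg C.TermDefRefined (funext fun i => ?_)) (hnew f (h 0))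
    refine congrArg (U.fn (L := L.expand F) (ExpFunc.new f)) (funext fun k => ?_)
    obtain rfl := Subsingleton.elim k 0
    rfl

/-- Every `L(F)`-term becomes an `L`-term, if the values of the new functions do. -/
theorem termDefRefined_eval {C : Config U}
    (hnew : ∀ {s t : L.Sorts} (f : F s t) {u : C.I → U.base s}, C.TermDefRefined u →
      C.TermDefRefined fun i => U.unary f (u i))
    {V : Type v} {x : V → L.Sorts} {b : C.I → Tuple U.base x}
    (hb : ∀ k, C.TermDefRefined fun i => b i k) {s : L.Sorts}
    (t : Term (L.expand F) (x : V → (L.expand F).Sorts) s) :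
    C.TermDefRefined fun i => @Term.eval (L.expand F) U V x (b i) s t := by
  refine Term.rec (L := L.expand F) (x := x)
    (motive := fun s t => C.TermDefRefined (s := s) fun i => @Term.eval (L.expand F) U V x (b i) s t)
    hb ?_ t
  intro n σ s f ts ih
  exact termDefRefined_app hnew f ih

/-- Atomic formulas reduce to the values of their terms, and implications to further refinement. A
quantifier is out of reach, as its variable is not a function of the index. -/
theorem formDefRefined_realize {C : Config U}
    (hnew : ∀ {s t : L.Sorts} (f : F s t) {u : C.I → U.base s}, C.TermDefRefined u →
      C.TermDefRefined fun i => U.unary f (u i))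
    {V : Type v} {x : V → L.Sorts} {b : C.I → Tuple U.base x}
    (hb : ∀ k, C.TermDefRefined fun i => b i k) {n : ℕ} {σ : Fin n → L.Sorts}
    (φ : BFormula (L.expand F) (x : V → (L.expand F).Sorts) n σ) (hφ : φ.IsQF)
    (d : C.I → Tuple U.base σ) (hd : ∀ k, C.TermDefRefined fun i => d i k) :
    C.FormDefRefined fun i =>
      @BFormula.Realize (L.expand F) U V x (b i) n σ φ (d i) := by
  have hterm : ∀ {n : ℕ} {σ : Fin n → L.Sorts} {d : C.I → Tuple U.base σ},
      (∀ k, C.TermDefRefined fun i => d i k) → ∀ {s : L.Sorts}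
      (t : Term (L.expand F) (Sum.elim x σ : V ⊕ Fin n → (L.expand F).Sorts) s),
      C.TermDefRefined fun i => @Term.eval (L.expand F) U _ (Sum.elim x σ)
        (Tuple.join (L := L.expand F) (M := U) (x := x) (y := σ) (b i) (d i)) s t := by
    intro n σ d hd s t
    refine termDefRefined_eval hnew (b := fun i => (b i).join (d i)) ?_ t
    rintro (k | k)
    exacts [hb k, hd k]
  revert d hφ
  refine BFormula.rec (L := L.expand F) (x := x)
    (motive := fun n σ φ => φ.IsQF → ∀ d : C.I → Tuple U.base (L := L) σ,
      (∀ k, C.TermDefRefined (s := σ k) fun i => d i k) →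
      C.FormDefRefined fun i => @BFormula.Realize (L.expand F) U V x (b i) n σ φ (d i))
    ?_ ?_ ?_ ?_ ?_ φ
  · exact fun _ d _ C' r => ⟨C', Refinement.refl C', .falsum, fun i => Iff.rfl⟩
  · exact fun t₁ t₂ _ d hd => FormDefRefined.equal (hterm hd t₁) (hterm hd t₂)
  · intro n σ m ρ R ts _ d hd
    have := FormDefRefined.rel (L := L) (C := C) (σ := ρ) R (fun k => hterm hd (ts k))
    exact this
  · exact fun φ ψ ih₁ ih₂ hφ d hd => FormDefRefined.imp (ih₁ hφ.1 d hd) (ih₂ hφ.2 d hd)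
  · exact fun s φ _ hφ => hφ.elim

end Config

end Expansion


/-! ### Eliminating one new function from a configuration -/

section Criterion

variable {L : Language.{u}} {F : L.Sorts → L.Sorts → Type u}

/-- Over a substructure closed under the new functions, the image under a new function of a
finitely generated extension is generated by a finite tuple in this image. -/
def Str.ImagesFinitelyGenerated (N : Str (L.expand F)) : Prop :=
  ∀ (s t : L.Sorts) (f : F s t),
    ∀ M : SSet N.base, (∃ r, (M r).Nonempty) → IsSubstructure M →
    (∀ (p q : L.Sorts) (g : F p q), ∀ a ∈ M p, N.unary g a ∈ M q) →
    ∀ (X : Type) [Finite X] (x : X → L.Sorts) (c : Tuple N.base x),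
    ∃ (Y : Type) (_ : Finite Y) (y : Y → L.Sorts) (d : Tuple N.base y),
      (∀ j, d j ∈ image N f (span N.base (M ⊔ c.coords)) (y j)) ∧
      image N f (span N.base (M ⊔ c.coords)) ≤ span N.base (image N f M ⊔ d.coords)

/-- Equations between a new function at a term and a term extend to the center of a sequence in
distal configuration. -/
def Str.EquationsExtend (U : Str (L.expand F)) : Prop :=
  ∀ (s t : L.Sorts) (f : F s t)
    (X' X'' Y Z : Type) [Finite X'] [Finite X''] [Finite Y] [Finite Z]
    (x' : X' → L.Sorts) (x'' : X'' → L.Sorts) (y : Y → L.Sorts) (z : Z → L.Sorts)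
    (g : Term L (Sum.elim (Sum.elim x' x'') y) s) (h : Term L (Sum.elim x' z) t)
    (b₁ : Tuple U.base y) (b₂ : Tuple U.base z),
    (∀ k, b₂ k ∈ image U f (fun _ => Set.univ) (z k)) →
    ∀ (I : Type u) [LinearOrder I] (c : I), DistalConfiguration c →
    ∀ (a' : I → Tuple U.base x') (a'' : I → Tuple U.base x''),
    (∀ i k, a' i k ∈ image U f (fun _ => Set.univ) (x' k)) →
    Indiscernible (L := L.expand F) (M := U) (x := Sum.elim x' x'')
      (fun i => (a' i).join (a'' i)) →
    IndiscernibleOver (L := L.expand F) (M := U) (x := Sum.elim x' x'')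
      (fun i => (a' i).join (a'' i)) {i | i ≠ c}
      (p := Sum.elim y z) (b₁.join b₂) →
    (∀ i, i ≠ c →
      U.unary f (g.eval U.base (((a' i).join (a'' i)).join b₁)) =
        h.eval U.base ((a' i).join b₂)) →
    U.unary f (g.eval U.base (((a' c).join (a'' c)).join b₁)) =
      h.eval U.base ((a' c).join b₂)

/-- Used to write the elements of `M⟨e⟩` as `L(F)`-terms in the generators of `M` and in `e`. -/
theorem InSpan.of_base {U : Str (L.expand F)} {A : SSet U} {P : Type v} {p : P → L.Sorts}
    {e : Tuple U.base p} {r : L.Sorts} {m : U.base r}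
    (hm : InSpan (M := U.base) ((span U A : SSet U) ⊔ e.coords) r m) :
    InSpan (L := L.expand F) (M := U)
      (A ⊔ Tuple.coords (L := L.expand F) (M := U) (x := p) e) r m := by
  induction hm with
  | base hm =>
    rcases hm with hm | hm
    · exact InSpan.mono (L := L.expand F) (M := U) le_sup_left hm
    · cases hm with
      | coord k => exact .base (Or.inr (InCoords.coord k))
  | app f a _ ih => exact InSpan.app (L := L.expand F) (M := U) (ExpFunc.old f) a ih

/-- The term can be chosen with outermost symbol `f`. Its value therefore remains in the image of
`f` when other members of the sequence are substituted, as condition 3 will require. -/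
theorem exists_term_of_mem_image {U : Str (L.expand F)} {s t : L.Sorts} (f : F s t)
    {A : SSet U.base} {I : Type u} {X : Type} {x : X → L.Sorts} {a : I → Tuple U.base x}
    {B : Set I} {P : Type v} {p : P → L.Sorts} {e : Tuple U.base p}
    (hA : ∀ r m, m ∈ A r → InSpan (L := L.expand F) (M := U)
      (seqCoords (L := L.expand F) (M := U) (x := x) a B ⊔
        Tuple.coords (L := L.expand F) (M := U) (x := p) e) r m)
    {r : L.Sorts} {b : U.base r} (hb : b ∈ image U f A r) :
    ∃ (S : Finset I) (τ : Term (L.expand F) (Sum.elim (fun q : S × X => x q.2) p) r),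
      (∀ i ∈ S, i ∈ B) ∧
      b = τ.eval U (seqTuple (L := L.expand F) (M := U) (x := x) a Subtype.val e) ∧
      ∀ d, τ.eval U d ∈ image U f (fun _ => Set.univ) r := by
  cases hb with
  | mk b hb =>
    obtain ⟨S, τ, hS, hτ⟩ := InSpan.exists_term_seq (L := L.expand F) (M := U) (hA _ _ hb)
    refine ⟨S, Term.app (L := L.expand F) (ExpFunc.new f) (fun _ => τ), hS, ?_, fun d => ?_⟩
    · exact congrArg (U.unary f) hτ
    · exact InImage.mk _ trivial

theorem image_mono (U : Str (L.expand F)) {s t : L.Sorts} (f : F s t) {A B : SSet U.base}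
    (h : A ≤ B) : image U f A ≤ image U f B := by
  rintro r b ⟨a, ha⟩
  exact InImage.mk a (h _ ha)

namespace Config

variable {U : Str (L.expand F)}

/-- The configuration given by terms in the sequence, the parameters and finitely many members of
the sequence, near the center. -/
def derive (C : Config U) {K : Type u} [Finite K] (J : K → C.I) (hJ : ∀ k, J k ≠ C.c)
    {X' : Type} [Finite X'] {x' : X' → L.Sorts} (a' : SameCut J C.c → Tuple U.base x')
    (ha' : ∀ k, ∃ α : Term (L.expand F) (Sum.elim (fun q : K × C.X => C.x q.2) C.x) (x' k),
      ∀ i, a' i k = α.eval U (seqTuple (L := L.expand F) (M := U) (x := C.x) C.a J (C.a i.1)))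
    {P' : Type} [Finite P'] {p' : P' → L.Sorts} (e' : Tuple U.base p')
    (he' : ∀ k, ∃ β : Term (L.expand F) (Sum.elim (fun q : K × C.X => C.x q.2) C.p) (p' k),
      e' k = β.eval U (seqTuple (L := L.expand F) (M := U) (x := C.x) C.a J C.e)) :
    Config U where
  I := SameCut J C.c
  c := SameCut.center J C.c
  dist := C.dist.sameCut hJ
  X := X'
  x := x'
  a := a'
  P := P'
  p := p'
  e := e'
  ind := IndiscernibleOver.of_terms_seq (L := L.expand F) (M := U) C.ind (J := J)
    (fun _ => trivial) (ι := Subtype.val) (fun _ _ h => h) (fun _ _ => trivial)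
    (fun k i j => ⟨(i.2 k).1.trans (j.2 k).1.symm, (i.2 k).2.trans (j.2 k).2.symm⟩)
    ha' (fun k => k.elim)
  indOff := IndiscernibleOver.of_terms_seq (L := L.expand F) (M := U) C.indOff (J := J)
    hJ (ι := Subtype.val) (fun _ _ h => h) (S' := {i | i ≠ SameCut.center J C.c})
    (fun _ hi h => hi (Subtype.ext h))
    (fun k i j => ⟨(i.2 k).1.trans (j.2 k).1.symm, (i.2 k).2.trans (j.2 k).2.symm⟩)
    ha' he'

/-- With empty tuples the sequence generates possibly nothing, and condition 2 needs a nonempty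
substructure. But then `u` is constant, and its image under `f` can be added as a parameter. -/
theorem exists_refinement_unary_of_isEmpty (C : Config U) [IsEmpty C.X] {s t : L.Sorts}
    (f : F s t) {u : C.I → U.base s} (hu : C.TermDef u) :
    ∃ (C' : Config U) (r : C'.Refinement C), C'.TermDef fun i => U.unary f (u (r.map i)) := by
  obtain ⟨τ, hτ⟩ := hu
  have hconst : ∀ i, u i = u C.c := fun i => by
    rw [hτ, hτ, Subsingleton.elim (C.a i) (C.a C.c)]
  let C' : Config U := C.derive (K := PEmpty.{u + 1}) PEmpty.elim (fun k => k.elim) (x' := C.x)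
    (fun i => C.a i.1) (fun k => isEmptyElim k) (p' := Sum.elim C.p (fun _ : Unit => t))
    (Tuple.join C.e (fun _ => U.unary f (u C.c))) (by
      rintro (k | k)
      · exact ⟨Term.var (L := L.expand F) (Sum.inr k), rfl⟩
      · refine ⟨Term.app (L := L.expand F) (ExpFunc.new f) (fun _ => (τ.lift F).subst (fun
          | Sum.inl l => isEmptyElim l
          | Sum.inr l => Term.var (L := L.expand F) (Sum.inr l))), ?_⟩
        refine congrArg (U.fn (L := L.expand F) (ExpFunc.new f)) (funext fun _ => ?_)
        refine Eq.trans ?_ (Term.eval_subst (L := L.expand F) U _ _ _).symm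
        rw [hτ, ← Term.eval_lift]
        congr 1
        funext l
        rcases l with l | l
        · exact isEmptyElim l
        · rfl)
  refine ⟨C', ⟨Subtype.val, rfl, fun i hi h => hi (Subtype.ext h), fun k => isEmptyElim k,
    fun k => ⟨(Term.var (Sum.inr (Sum.inl k)) : Term L (Sum.elim C'.x C'.p) (C.p k)),
      fun _ => rfl⟩⟩, (Term.var (Sum.inr (Sum.inr ())) : Term L (Sum.elim C'.x C'.p) t),
      fun i => ?_⟩
  exact congrArg (U.unary f) (hconst _)

/-- Condition 2 expresses the value at one index `i₀ < c`, indiscernibility off `c` spreads the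
equation to the indices around `c`, and condition 3 adds `c` itself. -/
theorem exists_refinement_unary (h2 : U.ImagesFinitelyGenerated) (h3 : U.EquationsExtend)
    (C : Config U) {s t : L.Sorts} (f : F s t) {u : C.I → U.base s} (hu : C.TermDef u) :
    ∃ (C' : Config U) (r : C'.Refinement C), C'.TermDef fun i => U.unary f (u (r.map i)) := by
  classical
  rcases isEmpty_or_nonempty C.X with hX | ⟨⟨k₀⟩⟩
  · exact C.exists_refinement_unary_of_isEmpty f hu
  obtain ⟨τ, hτ⟩ := hu
  -- Only members below `c` are used as generators: all indices that occur then avoid `c`, and the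
  -- right side is free to receive the moved ones.
  let A : SSet U := seqCoords (L := L.expand F) (M := U) (x := C.x) C.a (Set.Iio C.c)
  let M : SSet U.base := span (L := L.expand F) U A
  obtain ⟨m₀, hm₀⟩ := C.dist.1.nonempty
  obtain ⟨Y, _, y, d, hd, hgen⟩ := h2 s t f M
    ⟨C.x k₀, C.a m₀ k₀, InSpan.base ⟨m₀, hm₀, InCoords.coord k₀⟩⟩
    (fun f a ha => InSpan.app (L := L.expand F) (M := U) (ExpFunc.old f) a ha)
    (fun p q g a ha => InSpan.app (L := L.expand F) (M := U) (ExpFunc.new g)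
      (fun _ => a) (fun _ => ha)) C.P C.p C.e
  -- The tuple `d` is given by terms in the parameters and finitely many members below `c`.
  have hd' := fun j => exists_term_of_mem_image (L := L) f (A := span U.base (M ⊔ C.e.coords))
    (a := C.a) (B := Set.Iio C.c) (e := C.e) (fun r m hm => InSpan.of_base hm) (hd j)
  choose S₀ δ hS₀ hδ hδimg using hd'
  -- With `i₀` beyond all indices used by `d`, these can stay in place and `d` remains the same when
  -- `i₀` varies.
  obtain ⟨i₀, hi₀, hi₀S⟩ : ∃ i₀ < C.c, ∀ j, ∀ i ∈ S₀ j, i < i₀ := by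
    have := Fintype.ofFinite Y
    obtain ⟨m, hm, hmax⟩ := Finset.exists_max_image (insert m₀ (Finset.univ.biUnion S₀)) id
      ⟨m₀, Finset.mem_insert_self _ _⟩
    have hmc : m < C.c := by
      rcases Finset.mem_insert.1 hm with rfl | hm
      · exact hm₀
      · obtain ⟨j, -, hj⟩ := Finset.mem_biUnion.1 hm
        exact hS₀ j m hj
    obtain ⟨i, hi, hmi⟩ : ∃ i < C.c, m < i := by
      by_contra! h
      exact C.dist.2.2.1 ⟨m, hmc, h⟩
    exact ⟨i, hi, fun j k hk => (hmax k (Finset.mem_insert_of_mem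
      (Finset.mem_biUnion.2 ⟨j, Finset.mem_univ j, hk⟩))).trans_lt hmi⟩
  -- The value at `i₀` is a term in `d` and finitely many elements of `f(M)`.
  have hval : InSpan (image U f M ⊔ d.coords) t (U.unary f (u i₀)) := by
    refine hgen t (InImage.mk _ ?_)
    rw [hτ]
    refine Term.eval_mem_span ?_ τ
    rintro (k | k)
    · exact Or.inl (InSpan.base ⟨i₀, hi₀, InCoords.coord k⟩)
    · exact Or.inr (InCoords.coord k)
  obtain ⟨W, _, z, w, h, hw, hh⟩ := hval.exists_term
  have hw' := fun k => exists_term_of_mem_image (L := L) f (A := M) (a := C.a) (B := Set.Iio C.c)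
    (p := (Empty.elim : Empty → L.Sorts)) (e := Tuple.nil)
    (fun r m hm => InSpan.mono (L := L.expand F) (M := U) le_sup_left hm) (hw k)
  choose S₁ θ hS₁ hθ hθimg using hw'
  obtain ⟨S, hS⟩ : ∃ S : Finset C.I, ∀ i, i ∈ S ↔ i = i₀ ∨ (∃ j, i ∈ S₀ j) ∨ ∃ k, i ∈ S₁ k := by
    have := Fintype.ofFinite Y
    have := Fintype.ofFinite W
    exact ⟨insert i₀ (Finset.univ.biUnion S₀ ∪ Finset.univ.biUnion S₁), by simp⟩
  have hSc : ∀ i ∈ S, i < C.c := by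
    intro i hi
    rcases (hS i).1 hi with rfl | ⟨j, hj⟩ | ⟨k, hk⟩
    exacts [hi₀, hS₀ j i hj, hS₁ k i hk]
  -- The members above `i₀` are moved above `c`.
  obtain ⟨ρ, hρ, hρc⟩ := exists_strictMono_into (K := S) C.dist.2.1
  -- At `i₀` itself `J` has a value without meaning, which `r` overrides; it only has to differ from
  -- `c`, and at worst it narrows the cut.
  let J : S → C.I := fun k => if k.1 < i₀ then k.1 else ρ k
  have hJlt : ∀ k : S, k.1 < i₀ → J k = k.1 := fun k hk => if_pos hk
  have hJgt : ∀ k : S, i₀ < k.1 → J k = ρ k := fun k hk => if_neg hk.not_gt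
  have hJ : ∀ k, J k ≠ C.c := by
    intro k
    by_cases hk : k.1 < i₀
    · rw [hJlt k hk]; exact (hk.trans hi₀).ne
    · simp only [J, if_neg hk]; exact (hρc k).ne'
  let i₀' : S := ⟨i₀, (hS i₀).2 (Or.inl rfl)⟩
  let r : C.I → S → C.I := fun i k => if k = i₀' then i else J k
  have hri₀ : ∀ i, r i i₀' = i := fun i => if_pos rfl
  have hrJ : ∀ i k, k ≠ i₀' → r i k = J k := fun i k hk => if_neg hk
  have hrpat : ∀ (i : SameCut J C.c) (k l : S), k.1 < l.1 ↔ r i k < r i l := by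
    intro i
    have hlow : ∀ k : S, k < i₀' → r i k = k.1 ∧ k.1 < i.1 ∧ k.1 < C.c := fun k hk => by
      have h₁ := hJlt k hk
      refine ⟨(hrJ _ k hk.ne).trans h₁, ?_, hSc k k.2⟩
      rw [← h₁, (i.2 k).1, h₁]
      exact hSc k k.2
    have hhigh : ∀ k : S, i₀' < k → r i k = ρ k ∧ i.1 < ρ k ∧ C.c < ρ k := fun k hk => by
      have h₁ := hJgt k hk
      refine ⟨(hrJ _ k hk.ne').trans h₁, ?_, hρc k⟩
      rw [← h₁, (i.2 k).2, h₁]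
      exact hρc k
    intro k l
    change k < l ↔ _
    rcases lt_trichotomy k i₀' with hk | rfl | hk <;> rcases lt_trichotomy l i₀' with hl | hl | hl
    · rw [(hlow k hk).1, (hlow l hl).1]; rfl
    · rw [(hlow k hk).1, hl, hri₀]; exact iff_of_true hk (hlow k hk).2.1
    · rw [(hlow k hk).1, (hhigh l hl).1]
      exact iff_of_true (hk.trans hl) ((hlow k hk).2.2.trans (hhigh l hl).2.2)
    · rw [hri₀, (hlow l hl).1]; exact iff_of_false hl.not_gt (hlow l hl).2.1.not_gt
    · rw [hl]; simp
    · rw [hri₀, (hhigh l hl).1]; exact iff_of_true hl (hhigh l hl).2.1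
    · rw [(hhigh k hk).1, (hlow l hl).1]
      exact iff_of_false (hl.trans hk).not_gt ((hlow l hl).2.2.trans (hhigh k hk).2.2).not_gt
    · rw [(hhigh k hk).1, hl, hri₀]; exact iff_of_false hk.not_gt (hhigh k hk).2.1.not_gt
    · rw [(hhigh k hk).1, (hhigh l hl).1, hρ.lt_iff_lt]
  let f₀ : ∀ j, S₀ j → S := fun j k => ⟨k.1, (hS _).2 (Or.inr (Or.inl ⟨j, k.2⟩))⟩
  let f₁ : ∀ k, S₁ k → S := fun k l => ⟨l.1, (hS _).2 (Or.inr (Or.inr ⟨k, l.2⟩))⟩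
  choose δ' hδ' using fun j => (δ j).exists_reindex (f₀ j)
  choose θ' hθ' using fun k => (θ k).exists_reindex (f₁ k)
  have hδr : ∀ j (r : S → C.I), (∀ k, r (f₀ j k) = k.1) → (δ' j).eval U
      (seqTuple (L := L.expand F) (M := U) (x := C.x) C.a r C.e) = d j := fun j r hr =>
    (hδ' j U C.I C.a r C.e).trans ((congrArg (fun r => (δ j).eval U
      (seqTuple (L := L.expand F) (M := U) (x := C.x) C.a r C.e)) (funext hr)).trans (hδ j).symm)
  have hJf₀ : ∀ j k, J (f₀ j k) = k.1 := fun j k => hJlt _ (hi₀S j _ k.2)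
  let wr : (S → C.I) → Tuple U.base z := fun r k => (θ' k).eval U
    (seqTuple (L := L.expand F) (M := U) (x := C.x) C.a r Tuple.nil)
  let dr : (S → C.I) → Tuple U.base y := fun r j => (δ' j).eval U
    (seqTuple (L := L.expand F) (M := U) (x := C.x) C.a r C.e)
  -- The equation holds off the center.
  have heq : ∀ r : S → C.I, (∀ k, r k ≠ C.c) → (∀ k l : S, k.1 < l.1 ↔ r k < r l) →
      U.unary f (u (r i₀')) = h.eval U.base ((wr r).join (dr r)) := by
    -- As `w` and `d` are given by `L(F)`-terms, the equation is a single `L(F)`-formula in the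
    -- members `a (r k)` and `e`.
    have hLF : ∃ χ : Formula (L.expand F) (Sum.elim (fun q : S × C.X => C.x q.2) C.p),
        ∀ r : S → C.I, χ.Holds U (seqTuple (L := L.expand F) (M := U) (x := C.x) C.a r C.e) ↔
          U.unary f (u (r i₀')) = h.eval U.base ((wr r).join (dr r)) := by
      obtain ⟨χ, hχ⟩ := Formula.exists_equal (L := L.expand F)
        (x := Sum.elim (fun q : S × C.X => C.x q.2) C.p)
        (Term.app (L := L.expand F) (ExpFunc.new f) (fun _ => (τ.lift F).subst (fun
          | Sum.inl k => Term.var (L := L.expand F)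
              (x := Sum.elim (fun q : S × C.X => C.x q.2) C.p) (Sum.inl (i₀', k))
          | Sum.inr k => Term.var (L := L.expand F)
              (x := Sum.elim (fun q : S × C.X => C.x q.2) C.p) (Sum.inr k))))
        ((h.lift F).subst (fun
          | Sum.inl k => (θ' k).subst (fun
            | Sum.inl q => Term.var (L := L.expand F)
                (x := Sum.elim (fun q : S × C.X => C.x q.2) C.p) (Sum.inl q)
            | Sum.inr l => l.elim)
          | Sum.inr j => δ' j))
      refine ⟨χ, fun r => (hχ U _).trans (iff_of_eq (congrArg₂ Eq ?_ ?_))⟩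
      · refine congrArg (U.fn (L := L.expand F) (ExpFunc.new f)) (funext fun _ => ?_)
        refine (Term.eval_subst (L := L.expand F) U _ _ _).trans ?_
        rw [hτ, ← Term.eval_lift]
        congr 1
        funext l
        cases l <;> rfl
      · refine (Term.eval_subst (L := L.expand F) U _ _ _).trans ?_
        rw [← Term.eval_lift]
        congr 1
        funext l
        rcases l with l | l
        · refine (Term.eval_subst (L := L.expand F) U _ _ _).trans ?_
          congr 1
          funext q
          rcases q with q | q
          · rfl
          · exact q.elim
        · rfl
    obtain ⟨χ, hχ⟩ := hLF
    intro r hr hpat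
    -- The inclusion of `S` has the same order pattern as `r`, and both avoid `c`; for the inclusion
    -- the equation is `hh`.
    refine (hχ r).1 ((IndiscernibleOver.holds_iff (L := L.expand F) (M := U) C.indOff Subtype.val r
      (fun k => (hSc k k.2).ne) hr hpat χ).1 ((hχ _).2 ?_))
    have h₁ : wr Subtype.val = w := funext fun k => (hθ' k _ _ _ _ _).trans (hθ k).symm
    have h₂ : dr Subtype.val = d := funext fun j => hδr j _ fun _ => rfl
    rw [h₁, h₂]
    exact hh
  have hdr : ∀ i, dr (r i) = d := by
    intro i
    funext j
    exact hδr j _ fun k => (hrJ _ _ fun h =>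
      (hi₀S j _ k.2).ne (congrArg Subtype.val h)).trans (hJf₀ j k)
  let C' : Config U := C.derive J hJ (x' := Sum.elim z C.x)
    (fun i => Tuple.join (wr (r i)) (C.a i.1)) (by
      rintro (k | k)
      -- In the term for `w` the slot of `i₀` takes the running member of the sequence; all other
      -- slots take fixed members indexed by `J`.
      · have hq : ∀ q : S × C.X, ∃ t : Term (L.expand F)
            (Sum.elim (fun q : S × C.X => C.x q.2) C.x) (C.x q.2), ∀ i,
            t.eval U (seqTuple (L := L.expand F) (M := U) (x := C.x) C.a J (C.a i)) =
              C.a (r i q.1) q.2 := by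
          intro q
          by_cases hq : q.1 = i₀'
          · refine ⟨Term.var (L := L.expand F) (Sum.inr q.2), fun i => ?_⟩
            rw [hq, hri₀]; rfl
          · refine ⟨Term.var (L := L.expand F) (Sum.inl q), fun i => ?_⟩
            rw [hrJ _ _ hq]; rfl
        choose ξ hξ using hq
        refine ⟨(θ' k).subst (fun | Sum.inl q => ξ q | Sum.inr l => l.elim), fun i => ?_⟩
        refine Eq.trans ?_ (Term.eval_subst (L := L.expand F) U _ _ _).symm
        refine congrArg (fun b => Term.eval U b (θ' k)) (funext fun l => ?_)
        rcases l with q | l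
        · exact (hξ q i.1).symm
        · exact l.elim
      · exact ⟨Term.var (L := L.expand F) (Sum.inr k), fun _ => rfl⟩)
    (p' := Sum.elim C.p y) (Tuple.join C.e d) (by
      rintro (k | j)
      · exact ⟨Term.var (L := L.expand F) (Sum.inr k), rfl⟩
      · exact ⟨δ' j, (hδr j J (hJf₀ j)).symm⟩)
  have hall : ∀ i : SameCut J C.c, U.unary f (u i.1) =
      h.eval U.base ((wr (r i)).join d) := by
    have hoff : ∀ i : SameCut J C.c, i ≠ SameCut.center J C.c → U.unary f (u i.1) =
        h.eval U.base ((wr (r i)).join d) := by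
      intro i hi
      have := heq (r i) (fun k => by
        by_cases hk : k = i₀'
        · rw [hk, hri₀]; exact fun h => hi (Subtype.ext h)
        · rw [hrJ _ _ hk]; exact hJ k) (hrpat i)
      rwa [hri₀, hdr] at this
    let g : Term L (Sum.elim (Sum.elim z C.x) C.p) s := τ.subst (fun
      | Sum.inl k => (Term.var (Sum.inl (Sum.inr k)) :
          Term L (Sum.elim (Sum.elim z C.x) C.p) (C.x k))
      | Sum.inr k => (Term.var (Sum.inr k) : Term L (Sum.elim (Sum.elim z C.x) C.p) (C.p k)))
    have hg : ∀ i : SameCut J C.c, g.eval U.base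
        (((wr (r i)).join (C.a i.1)).join C.e) = u i.1 := by
      intro i
      rw [hτ]
      refine (Term.eval_subst U.base _ _ τ).trans ?_
      congr 1
      funext l
      cases l <;> rfl
    intro i
    by_cases hi : i = SameCut.center J C.c
    · rw [hi, ← hg]
      -- The tuples `w_i` play the role of the initial segment `x'`, the old members that of the
      -- rest of `x`, with `b₁ = e` and `b₂ = d`.
      refine h3 s t f W C.X C.P Y z C.x C.p y g h C.e d
        (fun j => image_mono U f (fun _ _ _ => trivial) _ (hd j)) C'.I C'.c C'.dist
        (fun i => wr (r i.1)) (fun i => C.a i.1) (fun i k => ?_) C'.ind C'.indOff (fun i hi => ?_)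
      · refine cast (congrArg (· ∈ image U f (fun _ => Set.univ) (z k)) ?_) (hθimg k
          (seqTuple (L := L.expand F) (M := U) (x := C.x) C.a (fun l => r i.1 (f₁ k l)) Tuple.nil))
        exact (hθ' k U C.I C.a (r i.1) Tuple.nil).symm
      · exact (congrArg (U.unary f) (hg i)).trans (hoff i hi)
    · exact hoff i hi
  refine ⟨C', ⟨Subtype.val, rfl, fun i hi h => hi (Subtype.ext h),
    fun k => ⟨(Term.var (Sum.inl (Sum.inr k)) : Term L (Sum.elim C'.x C'.p) (C.x k)),
      fun _ => rfl⟩,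
    fun k => ⟨(Term.var (Sum.inr (Sum.inl k)) : Term L (Sum.elim C'.x C'.p) (C.p k)),
      fun _ => rfl⟩⟩, h.subst (fun
        | Sum.inl k => (Term.var (Sum.inl (Sum.inl k)) : Term L (Sum.elim C'.x C'.p) (z k))
        | Sum.inr j => (Term.var (Sum.inr (Sum.inr j)) : Term L (Sum.elim C'.x C'.p) (y j))),
      fun i => ?_⟩
  refine (hall i).trans (Eq.trans ?_ (Term.eval_subst U.base _ _ h).symm)
  congr 1
  funext l
  cases l <;> rfl

end Config

end Criterion


/-! ### From configurations to distality of the expansion -/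

theorem Formula.exists_finite_params {L : Language.{u}} {Y : Type v} {y : Y → L.Sorts}
    {Q : Type w} {q : Q → L.Sorts} (φ : Formula L (Sum.elim y q)) :
    ∃ (P : Type) (_ : Finite P) (g : P → Q) (φ' : Formula L (Sum.elim y fun k => q (g k))),
      ∀ (M : Str L) (a : Tuple M y) (d : Tuple M q), φ.Holds M (a.join d) ↔
        φ'.Holds M (Tuple.join (y := fun k => q (g k)) a fun k => d (g k)) := by
  obtain ⟨W, _, j, φ', hφ'⟩ := φ.exists_finite_support
  let P : Type := {w : W // ∃ k, j w = Sum.inr k}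
  let g : P → Q := fun w => w.2.choose
  have hg : ∀ w k, j w = Sum.inr k → ∃ l : P, g l = k := fun w k h =>
    ⟨⟨w, k, h⟩, Sum.inr_injective (((⟨w, k, h⟩ : P).2.choose_spec).symm.trans h)⟩
  have hterm : ∀ i : Y ⊕ Q, (∀ k, i = Sum.inr k → ∃ l : P, g l = k) →
      ∃ t : Term L (Sum.elim y fun k => q (g k)) (Sum.elim y q i),
        ∀ (M : Str L) (a : Tuple M y) (d : Tuple M q),
          t.eval M (Tuple.join (y := fun k => q (g k)) a fun k => d (g k)) = a.join d i := by
    rintro (i | k) h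
    · exact ⟨(Term.var (Sum.inl i) : Term L (Sum.elim y fun k => q (g k)) (y i)),
        fun _ _ _ => rfl⟩
    · obtain ⟨l, rfl⟩ := h k rfl
      exact ⟨(Term.var (Sum.inr l) : Term L (Sum.elim y fun k => q (g k)) (q (g l))),
        fun _ _ _ => rfl⟩
  choose θ hθ using fun w => hterm (j w) (hg w)
  refine ⟨P, inferInstance, g, φ'.subst θ, fun M a d => (hφ' M _).trans ?_⟩
  rw [Formula.holds_subst, funext fun w => hθ w M a d]

theorem IndiscernibleOver.holds_iff_single {L : Language.{u}} {M : Str L} {X : Type}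
    {x : X → L.Sorts} {I : Type u} [LinearOrder I] {a : I → Tuple M x} {J : Set I}
    {P : Type v} {p : P → L.Sorts} {e : Tuple M p} (ha : IndiscernibleOver a J e) {i j : I}
    (hi : i ∈ J) (hj : j ∈ J) (φ : Formula L (Sum.elim x p)) :
    φ.Holds M ((a i).join e) ↔ φ.Holds M ((a j).join e) := by
  let θ : ∀ k, Term L (Sum.elim (fun q : Unit × X => x q.2) p) (Sum.elim x p k) := fun
    | Sum.inl k => (Term.var (Sum.inl ((), k)) :
        Term L (Sum.elim (fun q : Unit × X => x q.2) p) (x k))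
    | Sum.inr k => (Term.var (Sum.inr k) :
        Term L (Sum.elim (fun q : Unit × X => x q.2) p) (p k))
  have hθ : ∀ i, (fun k => (θ k).eval M (Tuple.join (x := fun q : Unit × X => x q.2)
      (fun q => a i q.2) e)) = (a i).join e := fun i => by
    funext k; cases k <;> rfl
  have := ha.holds_iff (fun _ : Unit => i) (fun _ => j) (fun _ => hi) (fun _ => hj)
    (fun _ _ => by simp) (φ.subst θ)
  rwa [Formula.holds_subst, Formula.holds_subst, hθ, hθ] at this

theorem distalConfiguration_rat : DistalConfiguration (⟨0⟩ : ULift.{u} ℚ) := by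
  refine ⟨?_, ?_, ?_, ?_⟩
  · refine Set.infinite_of_injective_forall_mem (f := fun n : ℕ => (⟨-(n + 1)⟩ : ULift.{u} ℚ))
      (fun m n h => ?_) fun n => ?_
    · simpa using h
    · change (-(n + 1) : ℚ) < 0
      linarith [(Nat.cast_nonneg n : (0 : ℚ) ≤ n)]
  · refine Set.infinite_of_injective_forall_mem (f := fun n : ℕ => (⟨n + 1⟩ : ULift.{u} ℚ))
      (fun m n h => ?_) fun n => ?_
    · simpa using h
    · change (0 : ℚ) < n + 1
      linarith [(Nat.cast_nonneg n : (0 : ℚ) ≤ n)]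
  · rintro ⟨⟨q⟩, hq, hmax⟩
    change q < 0 at hq
    have : q / 2 ≤ q := hmax (a := ⟨q / 2⟩) (show q / 2 < 0 by linarith)
    linarith
  · rintro ⟨⟨q⟩, hq, hmin⟩
    change 0 < q at hq
    have : q ≤ q / 2 := hmin (a := ⟨q / 2⟩) (show 0 < q / 2 by linarith)
    linarith

/-- Relations defined by quantifier-free formulas of the expansion do not distinguish the center
of a configuration. -/
theorem Config.exists_holds_iff {L : Language.{u}} {F : L.Sorts → L.Sorts → Type u}
    {T : Theory L} (hT : T.IsDistal) {U : Str (L.expand F)} (hU : U.base.IsMonster T)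
    (h2 : U.ImagesFinitelyGenerated) (h3 : U.EquationsExtend) (C : Config U)
    (φ : Formula (L.expand F) (Sum.elim C.x C.p : C.X ⊕ C.P → (L.expand F).Sorts))
    (hφ : BFormula.IsQF φ) :
    ∃ i, i ≠ C.c ∧ (@Formula.Holds (L.expand F) U _ (Sum.elim C.x C.p) φ ((C.a C.c).join C.e) ↔
      @Formula.Holds (L.expand F) U _ (Sum.elim C.x C.p) φ ((C.a i).join C.e)) := by
  have hnew : ∀ {s t : L.Sorts} (f : F s t) {u : C.I → U.base s}, C.TermDefRefined u →
      C.TermDefRefined fun i => U.unary f (u i) := by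
    intro s t f u hu C' r
    obtain ⟨C₁, r₁, h₁⟩ := hu C' r
    obtain ⟨C₂, r₂, h₂⟩ := C₁.exists_refinement_unary h2 h3 f h₁
    exact ⟨C₂, r₂.trans r₁, h₂⟩
  obtain ⟨C', r, φ', hφ'⟩ := Config.formDefRefined_realize hnew
    (b := fun i => (C.a i).join C.e) (by
      rintro (k | k)
      · exact TermDef.refined
          ⟨(Term.var (Sum.inl k) : Term L (Sum.elim C.x C.p) (C.x k)), fun _ => rfl⟩
      · exact TermDef.refined
          ⟨(Term.var (Sum.inr k) : Term L (Sum.elim C.x C.p) (C.p k)), fun _ => rfl⟩)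
    φ hφ (fun _ k => k.elim0) (fun k => k.elim0) C (Config.Refinement.refl C)
  obtain ⟨i, hi⟩ := C'.dist.1.nonempty
  -- Distality of `T` enters here, applied to the `L`-reduct of the refined configuration. Passing
  -- from the tuple `e` to its coordinate set and back only renames parameters.
  have hind : IndiscernibleOver (M := U.base) C'.a Set.univ C'.e :=
    (hT U.base hU C'.e.coords C'.X C'.x C'.I C'.c C'.dist.1 C'.dist.2.1 C'.a
      (IndiscernibleOver.base C'.ind)
      (C'.indOff.base.of_terms fun k => Term.exists_var_of_inCoords k.2.2)).of_terms fun k =>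
        ⟨(Term.var (Sigma.mk (C'.p k) (Subtype.mk (C'.e k) (InCoords.coord k))) :
          Term L C'.e.coords.elemSort (C'.p k)), rfl⟩
  refine ⟨r.map i, r.map_ne i (ne_of_lt hi), ?_⟩
  rw [← r.map_center]
  exact (hφ' C'.c).trans ((hind.holds_iff_single trivial trivial φ').trans (hφ' i).symm)

end ManySorted

theorem mainTheorem4
    (L : ManySorted.Language.{u}) (F : L.Sorts → L.Sorts → Type u)
    (T : Theory L) (hT : T.IsComplete)
    (TF : Theory (L.expand F)) (hTF : TF.IsComplete)
    -- `TF` extends `T`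
    (hext : ∀ N : Str (L.expand F), N.Models TF → N.base.Models T)
    (U : Str (L.expand F)) (hU : U.IsMonster TF)
    (hdistal : T.IsDistal)
    (h1 : TF.HasQE)
    (h2 : ∀ (s t : L.Sorts) (f : F s t) (N : Str (L.expand F)), N.Models TF →
      ∀ M : SSet N.base, (∃ r, (M r).Nonempty) → IsSubstructure M →
      (∀ (p q : L.Sorts) (g : F p q), ∀ a ∈ M p, N.unary g a ∈ M q) →
      ∀ (X : Type) [Finite X] (x : X → L.Sorts) (c : Tuple N.base x),
      ∃ (Y : Type) (_ : Finite Y) (y : Y → L.Sorts) (d : Tuple N.base y),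
        (∀ j, d j ∈ image N f (span N.base (M ⊔ c.coords)) (y j)) ∧
        image N f (span N.base (M ⊔ c.coords)) ≤
          span N.base (image N f M ⊔ d.coords))
    (h3 : ∀ (s t : L.Sorts) (f : F s t)
      -- `x` is the concatenation of its initial segment `x'` and the rest `x''`
      (X' X'' Y Z : Type) [Finite X'] [Finite X''] [Finite Y] [Finite Z]
      (x' : X' → L.Sorts) (x'' : X'' → L.Sorts) (y : Y → L.Sorts) (z : Z → L.Sorts)
      (g : Term L (Sum.elim (Sum.elim x' x'') y) s) (h : Term L (Sum.elim x' z) t)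
      (b₁ : Tuple U.base y) (b₂ : Tuple U.base z),
      (∀ k, b₂ k ∈ image U f (fun _ => Set.univ) (z k)) →
      ∀ (I : Type u) [LinearOrder I] (c : I), DistalConfiguration c →
      ∀ (a' : I → Tuple U.base x') (a'' : I → Tuple U.base x''),
      (∀ i k, a' i k ∈ image U f (fun _ => Set.univ) (x' k)) →
      -- indiscernibility refers to the language `L(F)`
      Indiscernible (L := L.expand F) (M := U) (x := Sum.elim x' x'')
        (fun i => (a' i).join (a'' i)) →
      IndiscernibleOver (L := L.expand F) (M := U) (x := Sum.elim x' x'')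
        (fun i => (a' i).join (a'' i)) {i | i ≠ c}
        (p := Sum.elim y z) (b₁.join b₂) →
      (∀ i, i ≠ c →
        U.unary f (g.eval U.base (((a' i).join (a'' i)).join b₁)) =
          h.eval U.base ((a' i).join b₂)) →
      U.unary f (g.eval U.base (((a' c).join (a'' c)).join b₁)) =
        h.eval U.base ((a' c).join b₂)) :
    TF.IsDistal := by
  intro M hM A X _ x I _ c hI₁ hI₂ a ha haA
  -- It is enough to compare with tuples avoiding `c`: any two tuples are compared through a third
  -- one below `c`.
  suffices H : ∀ (n : ℕ) (φ : Formula (L.expand F)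
      (Sum.elim (fun k : Fin n × X => x k.2) A.elemSort)) (i j : Fin n → I),
      StrictMono i → StrictMono j → (∀ k, j k ≠ c) →
      (φ.Holds M (Tuple.join (fun k => a (i k.1) k.2) A.elemVal) ↔
        φ.Holds M (Tuple.join (fun k => a (j k.1) k.2) A.elemVal)) by
    intro n φ i j hi hj _ _
    obtain ⟨l, hl, hlc⟩ := exists_strictMono_into (K := Fin n) hI₁
    exact (H n φ i l hi hl fun k => (hlc k).ne).trans (H n φ j l hj hl fun k => (hlc k).ne).symm
  intro n φ i j hi hj hjc
  by_contra hne
  obtain ⟨P, _, g, φ', hφ'⟩ := φ.exists_finite_params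
  have hae : IndiscernibleOver a {i | i ≠ c} (fun k => A.elemVal (g k)) :=
    haA.of_terms fun k => ⟨Term.var (g k), rfl⟩
  rw [hφ', hφ'] at hne
  obtain ⟨-, κ, hκ, hsat, -⟩ := id hU
  -- The counterexample moves from `M` to the fixed monster model `U`. Its new index set, a lift of
  -- the rationals, is countable and in distal configuration at `0`, and each new member is a block
  -- of `n` old ones.
  obtain ⟨b, e, hb, hbe, hne⟩ := exists_stretched_sequence hTF hM.1 hU.1 hsat
    ((le_max_left _ _).trans hκ.le) hI₁ hI₂ ha hae hi hj hjc hne (ULift.{u} ℚ)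
    (z := ⟨0⟩) (w := ⟨1⟩) (by simp)
  obtain ⟨ψ, hψ, hφψ⟩ := h1 _ _ φ'
  let C : Config U :=
    { I := ULift.{u} ℚ
      c := ⟨0⟩
      dist := distalConfiguration_rat
      X := Fin n × X
      x := fun k => x k.2
      a := b
      P := P
      p := fun k => A.elemSort (g k)
      e := e
      ind := hb
      indOff := hbe }
  obtain ⟨q, hq, h⟩ := C.exists_holds_iff hdistal (hU.base (hext U hU.1))
    (fun s t f => h2 s t f U hU.1) h3 ψ hψ
  -- The index `q` need not be `1`, but off the center all members satisfy the same formulas over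
  -- `e`.
  refine hne (((hφψ U hU.1 _).trans (h.trans (hφψ U hU.1 _).symm)).trans ?_)
  exact hbe.holds_iff_single hq (show (⟨1⟩ : ULift.{u} ℚ) ≠ ⟨0⟩ by simp) φ'
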